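/- Let $p$ be a prime, $k$ an algebraically closed field of characteristic $p$, and $n \ge 2$, $\lambda \ge 1$ integers. **Conventions.** For a nonzero meromorphic differential form $\omega = f(X)\,dX$ on $\mathbb P^1_k$, its order at $a \in k$ is $\mathrm{ord}_a(f)$ and its order at $\infty$ is $\mathrm{ord}_0(f(1/X)) - 2$. The form is *logarithmic* if $\omega = dF/F$ for some $F \in k(X)^\times$. For integers $m, n \geq 1$, a *space $L_{m+1,n}$* is an $n$-dimensional $\mathbb F_p$-vector space $\Omega$ of meromorphic differential forms on $\mathbb P^1_k$ such that every nonzero $\omega\in\Omega$ is logarithmic, has no zero in $k$, and has order $m-1$ at $\infty$. For a tuple $\underline a = (a_1,\dots,a_r)$ in a commutative ring of characteristic $p$, $\Delta_r(\underline a) = \det\big(a_j^{p^{i-1}}\big)_{1\le i,j\le r}$ is its Moore determinant. The Dickson invariants $c_{n,i} \in \mathbb F_p[X_1,\dots,X_n]$, $0\le i\le n$, are defined by $$\prod_{\epsilon \in \mathbb F_p^n} \Big(T - \sum_j \epsilon_j X_j\Big) = \sum_{i=0}^n (-1)^{n-i} c_{n,i}\, T^{p^i}.$$ Call an $n$-tuple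 $\underline Q = (Q_1,\dots,Q_n) \in k[X]^n$ *admissible* if every $Q_i$ has degree $\lambda$ and the leading coefficients $q_1,\dots,q_n$ satisfy $\Delta_n(q_1,\dots,q_n) \ne 0$. For such $\underline Q$ put $P = \Delta_n(\underline Q)$, $P_i = (-1)^{i-1}\Delta_{n-1}(\widehat{\underline Q_i})$, where $\widehat{\underline Q_i}$ is $\underline Q$ with $Q_i$ removed, and $\omega_i(\underline Q) = \frac{P_i}{P}\,dX$. **Theorem.** 1. Let $\omega_1,\dots,\omega_n$ be meromorphic differential forms on $\mathbb P^1_k$. Their $\mathbb F_p$-span is a space $L_{\lambda p^{n-1},n}$ if and only if there is an admissible $n$-tuple $\underline Q$ such that $\omega_i = \omega_i(\underline Q)$ for all $i$ and the $(p-1)$-th derivative of the polynomial $c_{n,n-1}(\underline Q)\in k[X]$ satisfies $c_{n,n-1}(\underline Q)^{(p-1)} = -1$. 2. Consequently, an $\mathbb F_p$-vector space $\Omega$ of meromorphic differential forms on $\mathbb P^1_k$ is a space $L_{\lambda p^{n-1},n}$ if and only if $\Omega = \langle \omega_1(\underline Q), \dots, \omega_n(\underline Q)\rangle_{\mathbb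 F_p}$ for some admissible $n$-tuple $\underline Q$ with $c_{n,n-1}(\underline Q)^{(p-1)} = -1$. 3. Let $\underline Q$ be an admissible $n$-tuple. If $\langle \omega_1(\underline Q), \dots, \omega_n(\underline Q)\rangle_{\mathbb F_p}$ contains a nonzero logarithmic form, then it is a space $L_{\lambda p^{n-1},n}$. 4. For every space $\Omega$ of type $L_{\lambda p^{n-1},n}$ there is an admissible $n$-tuple $\underline Q$ such that $P_i \mid P$ for every $i$ and $\Omega = \langle \omega_1(\underline Q), \dots, \omega_n(\underline Q)\rangle_{\mathbb F_p}$. -/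

import Mathlib

noncomputable section

namespace LSpace

open Polynomial KaehlerDifferential

/-! ### Meromorphic differential forms on the projective line -/

/-- Meromorphic differential forms on the projective line over `k`: the Kähler differentials of the
function field `k(X)` over `k`. -/
abbrev Form (k : Type*) [Field k] : Type _ := Ω[RatFunc k⁄k]

/-- The form `dX`. -/
def dX (k : Type*) [Field k] : Form k := D k (RatFunc k) RatFunc.X

/-- The isomorphism `Ω(k(X)) ≃ k(X)`, `f dX ↦ f` (see `coeffForm_symm_apply`). -/
def coeffForm (k : Type*) [Field k] : Form k ≃ₗ[RatFunc k] RatFunc k :=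
  haveI : Algebra.FormallyEtale k[X] (RatFunc k) :=
    Algebra.FormallyEtale.of_isLocalization (nonZeroDivisors k[X])
  (tensorKaehlerEquivOfFormallyEtale k k[X] (RatFunc k)).symm ≪≫ₗ
    (polynomialEquiv k).baseChange k[X] (RatFunc k) _ _ ≪≫ₗ
    TensorProduct.AlgebraTensorModule.rid k[X] (RatFunc k) (RatFunc k)

theorem coeffForm_dX (k : Type*) [Field k] : coeffForm k (dX k) = 1 := by
  have : Algebra.FormallyEtale k[X] (RatFunc k) :=
    Algebra.FormallyEtale.of_isLocalization (nonZeroDivisors k[X])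
  have h := tensorKaehlerEquivOfFormallyEtale_symm_D_algebraMap k k[X] (RatFunc k) X
  rw [RatFunc.algebraMap_X] at h
  simp [coeffForm, dX, h]

theorem coeffForm_smul_dX {k : Type*} [Field k] (f : RatFunc k) : coeffForm k (f • dX k) = f := by
  rw [map_smul, coeffForm_dX, smul_eq_mul, mul_one]

theorem coeffForm_symm_apply {k : Type*} [Field k] (f : RatFunc k) :
    (coeffForm k).symm f = f • dX k := by
  rw [LinearEquiv.symm_apply_eq, coeffForm_smul_dX]

/-- The order of a form `f dX` at a point of the projective line: at a finite point `a` it is the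
order of vanishing of `f` at `a`, and at infinity it is `(-deg f) - 2`, where `-deg f` is the order
of `f(1/X)` at `0`. Only used for nonzero forms. -/
def orderAt {k : Type*} [Field k] (ω : Form k) : OnePoint k → ℤ
  | some a => ((coeffForm k ω).num.rootMultiplicity a : ℤ)
      - ((coeffForm k ω).denom.rootMultiplicity a : ℤ)
  | none => -(coeffForm k ω).intDegree - 2

/-- A form is logarithmic if it is `dF / F` for some (nonzero) rational function `F`. -/
def IsLogarithmic {k : Type*} [Field k] (ω : Form k) : Prop :=
  ∃ F : RatFunc k, F ≠ 0 ∧ ω = F⁻¹ • D k (RatFunc k) F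

/-- `IsSpaceL p N n Ω` says that `Ω` is a space `L_{N,n}`, where `N = m + 1`: `m` and `n` are
positive, `Ω` has dimension `n` over `𝔽_p`, and every nonzero form in `Ω` is logarithmic, has order
`m - 1 = N - 2` at infinity, and has no zero at any other point. -/
structure IsSpaceL (p N n : ℕ) [Fact p.Prime] {k : Type*} [Field k] [Algebra (ZMod p) k]
    (Ω : Submodule (ZMod p) (Form k)) : Prop where
  one_lt : 1 < N
  pos : 0 < n
  finrank_eq : Module.finrank (ZMod p) Ω = n
  isLogarithmic : ∀ ω ∈ Ω, ω ≠ 0 → IsLogarithmic ω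
  orderAt_infty : ∀ ω ∈ Ω, ω ≠ 0 → orderAt ω OnePoint.infty = (N : ℤ) - 2
  orderAt_coe : ∀ ω ∈ Ω, ω ≠ 0 → ∀ a : k, orderAt ω (a : OnePoint k) ≤ 0

/-! ### Moore determinants and Dickson invariants -/

/-- The Moore determinant `Δ_n(a) = det (a_j ^ (p ^ i))`, for `0 ≤ i < n`. -/
def moore (p : ℕ) {n : ℕ} {R : Type*} [CommRing R] (a : Fin n → R) : R :=
  Matrix.det (Matrix.of fun i j : Fin n => a j ^ p ^ (i : ℕ))

/-- The `(n-1)`-tuple obtained from an `n`-tuple by removing its `i`-th entry. -/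
def hat {n : ℕ} {R : Type*} (a : Fin n → R) (i : Fin n) : Fin (n - 1) → R := fun j =>
  if (j : ℕ) < (i : ℕ) then a ⟨j, by omega⟩ else a ⟨j + 1, by omega⟩

theorem hat_eq_succAbove {n : ℕ} {R : Type*} (a : Fin (n + 1) → R) (i : Fin (n + 1)) :
    hat a i = a ∘ i.succAbove := by
  funext j
  by_cases h : (j : ℕ) < (i : ℕ)
  · have : i.succAbove j = j.castSucc := Fin.succAbove_of_castSucc_lt i j h
    simp only [hat, h, if_true, Function.comp_apply, this]
    rfl
  · have : i.succAbove j = j.succ := Fin.succAbove_of_le_castSucc i j (not_lt.mp h)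
    simp only [hat, h, if_false, Function.comp_apply, this]
    rfl

/-- The structural polynomial `∏_{v ∈ V} (T - v)` of the `𝔽_p`-vector space `V` spanned by the
indeterminates of `𝔽_p[X_1, …, X_n]`. -/
def structPoly (p n : ℕ) [Fact p.Prime] : (MvPolynomial (Fin n) (ZMod p))[X] :=
  ∏ ε : Fin n → ZMod p, (X - C (∑ j, ε j • MvPolynomial.X j))

/-- The Dickson invariants `c_{n,i}`, defined by
`∏_{v ∈ V} (T - v) = ∑_{i=0}^{n} (-1)^(n-i) c_{n,i} T^(p^i)`. -/
def dickson (p n i : ℕ) [Fact p.Prime] : MvPolynomial (Fin n) (ZMod p) :=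
  (-1) ^ (n - i) * (structPoly p n).coeff (p ^ i)

/-! ### Forms attached to tuples of polynomials -/

/-- `Q` is an `n`-tuple of polynomials of degree `lam` whose leading coefficients have nonzero Moore
determinant (for `lam ≥ 1`, `natDegree = lam` is the usual degree condition). -/
structure IsAdmissible (p lam : ℕ) {n : ℕ} {k : Type*} [Field k] (Q : Fin n → k[X]) : Prop where
  natDegree_eq : ∀ i, (Q i).natDegree = lam
  moore_leadingCoeff_ne_zero : moore p (fun i => (Q i).leadingCoeff) ≠ 0

/-- The polynomial `P_i = (-1)^(i-1) Δ_{n-1}(Q̂_i)`, with `i` running through `1, …, n`. The index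
in `Fin n` starts at `0`, so the sign is `(-1)^i` there. -/
def numerator (p : ℕ) {n : ℕ} {k : Type*} [Field k] (Q : Fin n → k[X]) (i : Fin n) : k[X] :=
  (-1) ^ (i : ℕ) * moore p (hat Q i)

/-- The form `ω_i = (P_i / Δ_n(Q)) dX`. -/
def formOf (p : ℕ) {n : ℕ} {k : Type*} [Field k] (Q : Fin n → k[X]) (i : Fin n) : Form k :=
  (algebraMap k[X] (RatFunc k) (numerator p Q i) / algebraMap k[X] (RatFunc k) (moore p Q)) • dX k

/-- The polynomial `c_{n,n-1}(Q)` has `(p-1)`-th derivative equal to `-1`. -/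
def DicksonCondition (p : ℕ) [Fact p.Prime] {n : ℕ} {k : Type*} [Field k] [Algebra (ZMod p) k]
    (Q : Fin n → k[X]) : Prop :=
  derivative^[p - 1] (MvPolynomial.aeval Q (dickson p n (n - 1))) = -1

end LSpace

end

/-!
The theorem rests on a duality between tuples `u = (u_1, …, u_n)` of rational functions and tuples
`Q = (Q_1, …, Q_n)`: they are dual (`IsDual`) if `∑ u_i Q_i^(p^j)` is `0` for `0 ≤ j < n - 1` and
`(-1)^(n-1)` for `j = n - 1`. By Cramer's rule (`isDual_iff`), if `Δ_n(Q) ≠ 0` then `u` is dual to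
`Q` exactly when `u_i = P_i / P`. Raising the relations to powers of `p` turns them into linear
equations for the `Q_i^(p^(n-1))` whose coefficients are conjugates of the `u_i`, so that `u` also
determines `Q` (`isDual_iff_pow`). Contragredient base changes over `𝔽_p` preserve duality, so a
statement about all nonzero combinations of the `u_i` or of the `Q_i` need only be proved for single
entries.

*The role of `c_{n,n-1}`.* The entries of `Q` are roots of the structural polynomial of their span,
whence `∑ u_i Q_i^(p^n) = (-1)^(n-1) c_{n,n-1}(Q)`. Differentiating this and the relations of
duality `p - 1` times, where the `p`-th powers are constants, gives
`u^(p-1) = c_{n,n-1}(Q)^(p-1) u^p` for all `u` in the span of the `u_i`, the exponents `(p-1)`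
denoting derivatives (`IsDual.iterate_derivation`). A logarithmic form `u dX` satisfies
`u^(p-1) = -u^p` (`iterate_ratDeriv_of_mem_logSpan`), and the converse holds if `u` is the inverse
of a polynomial (`mem_logSpan_of_iterate_ratDeriv`). Hence a single nonzero logarithmic form forces
`c_{n,n-1}(Q)^(p-1) = -1`, and this equation makes all forms logarithmic.

*From tuples to spaces.* The product formula for Moore determinants (`moore_eq_prod`) writes `P` as
`P_i` times a product of `p^(n-1)` combinations of the `Q_j`, all of degree `lam`. So `P_i` divides
`P`, and `u_i` is the inverse of a polynomial of degree `lam * p^(n-1)`, which gives the orders.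

*From spaces to tuples.* Over an algebraically closed field, `u dX` is logarithmic if and only if
`u` is a sum of simple fractions with residues in `𝔽_p` (`isLogarithmic_iff`). In a space
`L_{N,n}` every nonzero `u` is a constant divided by the product of `X - a` over its `N` poles
(`eq_div_prod_of_orderAt`). Substituting this into the formula for `Q_i^(p^(n-1))` and counting
exponents at each point shows that this function is a constant times the `p^(n-1)`-th power of the
product of the `X - a` over the points `a` that are poles of `u_i` but of no other `u_j`; so the
dual tuple consists of polynomials of degree `lam` (`exists_dual_entry`).
-/

noncomputable section

namespace LSpace

open Polynomial KaehlerDifferential Matrix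

/-! ### Moore determinants and structural polynomials -/

section Moore

theorem map_moore {p n : ℕ} {R S : Type*} [CommRing R] [CommRing S] (f : R →+* S) (a : Fin n → R) :
    moore p (f ∘ a) = f (moore p a) := by
  simp only [moore, RingHom.map_det]
  congr 1
  ext i j
  simp

/-- Expansion of a Moore determinant along its `i`-th column. -/
theorem moore_insertNth {p m : ℕ} {R : Type*} [CommRing R] (i : Fin (m + 1)) (t : R)
    (a : Fin m → R) :
    moore p (i.insertNth t a : Fin (m + 1) → R) =
      ∑ j : Fin (m + 1), (-1) ^ ((j : ℕ) + i) *
        Matrix.det (Matrix.of fun r c : Fin m => a c ^ p ^ (j.succAbove r : ℕ)) *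
          t ^ p ^ (j : ℕ) := by
  rw [moore, Matrix.det_succ_column _ i]
  refine Finset.sum_congr rfl fun j _ => ?_
  rw [mul_right_comm]
  congr 2
  · congr 1
    ext r c
    simp
  · simp

/-- The expansion of `moore_insertNth` with the inserted entry replaced by an indeterminate. -/
def moorePoly (p : ℕ) {m : ℕ} {R : Type*} [CommRing R] (i : Fin (m + 1)) (a : Fin m → R) : R[X] :=
  ∑ j : Fin (m + 1), C ((-1) ^ ((j : ℕ) + i) *
    Matrix.det (Matrix.of fun r c : Fin m => a c ^ p ^ (j.succAbove r : ℕ))) * X ^ p ^ (j : ℕ)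

theorem eval_moorePoly {p m : ℕ} {R : Type*} [CommRing R] (i : Fin (m + 1)) (a : Fin m → R)
    (t : R) :
    (moorePoly p i a).eval t = moore p (i.insertNth t a : Fin (m + 1) → R) := by
  rw [moore_insertNth, moorePoly, eval_finsetSum]
  simp

variable {p : ℕ} [Fact p.Prime]

/-- The `𝔽_p`-linear combination `∑ ε_i a_i` of a family `a` with coefficients `ε`. -/
def comb {n : ℕ} {M : Type*} [AddCommMonoid M] [Module (ZMod p) M] (ε : Fin n → ZMod p)
    (a : Fin n → M) : M :=
  ∑ i, ε i • a i

theorem comb_insertNth {m : ℕ} {M : Type*} [AddCommMonoid M] [Module (ZMod p) M] (i : Fin (m + 1))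
    (c : ZMod p) (ε : Fin m → ZMod p) (a : Fin (m + 1) → M) :
    comb (i.insertNth c ε) a = c • a i + comb ε (a ∘ i.succAbove) := by
  simp [comb, Fin.sum_univ_succAbove _ i]

theorem comb_sub_left {n : ℕ} {M : Type*} [AddCommGroup M] [Module (ZMod p) M]
    (ε δ : Fin n → ZMod p) (a : Fin n → M) : comb (ε - δ) a = comb ε a - comb δ a := by
  simp [comb, sub_smul]

theorem comb_neg_left {n : ℕ} {M : Type*} [AddCommGroup M] [Module (ZMod p) M]
    (ε : Fin n → ZMod p) (a : Fin n → M) : comb (-ε) a = -comb ε a := by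
  simp [comb]

theorem comb_single {n : ℕ} {M : Type*} [AddCommMonoid M] [Module (ZMod p) M]
    (i : Fin n) (a : Fin n → M) : comb (Pi.single i 1 : Fin n → ZMod p) a = a i := by
  simp [comb, Pi.single_apply, ite_smul]

theorem map_comb {n : ℕ} {M N : Type*} [AddCommGroup M] [Module (ZMod p) M] [AddCommGroup N]
    [Module (ZMod p) N] (f : M →+ N) (ε : Fin n → ZMod p) (a : Fin n → M) :
    f (comb ε a) = comb ε (f ∘ a) := by
  simp [comb, ZMod.map_smul]

variable {R : Type*} [CommRing R]

theorem coeff_moorePoly {m : ℕ} (i : Fin (m + 1)) (a : Fin m → R) (j : Fin (m + 1)) :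
    (moorePoly p i a).coeff (p ^ (j : ℕ)) = (-1) ^ ((j : ℕ) + i) *
      Matrix.det (Matrix.of fun r c : Fin m => a c ^ p ^ (j.succAbove r : ℕ)) := by
  rw [moorePoly, finsetSum_coeff, Finset.sum_eq_single j]
  · rw [coeff_C_mul, coeff_X_pow, if_pos rfl, mul_one]
  · intro l _ hl
    rw [coeff_C_mul, coeff_X_pow, if_neg, mul_zero]
    intro h
    exact hl (Fin.ext (Nat.pow_right_injective (Fact.out : p.Prime).two_le h)).symm
  · simp

theorem coeff_last_moorePoly {m : ℕ} (i : Fin (m + 1)) (a : Fin m → R) :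
    (moorePoly p i a).coeff (p ^ m) = (-1) ^ (m + (i : ℕ)) * moore p a := by
  have := coeff_moorePoly (p := p) i a (Fin.last m)
  simpa [moore] using this

theorem natDegree_moorePoly_le {m : ℕ} (i : Fin (m + 1)) (a : Fin m → R) :
    (moorePoly p i a).natDegree ≤ p ^ m := by
  refine natDegree_sum_le_of_forall_le _ _ fun j _ => ?_
  exact (natDegree_C_mul_X_pow_le _ _).trans
    (Nat.pow_le_pow_right (Fact.out : p.Prime).pos (by omega))

variable [Algebra (ZMod p) R]

theorem charP_of_algebra_zmod (p : ℕ) [Fact p.Prime] (R : Type*) [CommRing R] [Nontrivial R]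
    [Algebra (ZMod p) R] : CharP R p :=
  charP_of_injective_algebraMap (algebraMap (ZMod p) R).injective p

theorem zmod_smul_pow (c : ZMod p) (x : R) (j : ℕ) : (c • x) ^ p ^ j = c • x ^ p ^ j := by
  rw [_root_.smul_pow, ZMod.pow_card_pow]

theorem sum_pow_prime_pow [Nontrivial R] {ι : Type*} (s : Finset ι) (f : ι → R) (j : ℕ) :
    (∑ i ∈ s, f i) ^ p ^ j = ∑ i ∈ s, f i ^ p ^ j := by
  have := charP_of_algebra_zmod p R
  exact map_sum (iterateFrobenius R p j) f s

theorem comb_pow [Nontrivial R] {n : ℕ} (ε : Fin n → ZMod p) (a : Fin n → R) (j : ℕ) :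
    comb ε a ^ p ^ j = comb ε (fun i => a i ^ p ^ j) := by
  simp only [comb, sum_pow_prime_pow, zmod_smul_pow]

/-- The matrix of the Moore determinant. -/
def mooreMatrix (p : ℕ) {n : ℕ} {R : Type*} [CommRing R] (a : Fin n → R) :
    Matrix (Fin n) (Fin n) R :=
  Matrix.of fun i j : Fin n => a j ^ p ^ (i : ℕ)

/-- Since `ε_i ^ p = ε_i`, a relation between the entries is a relation between the columns. -/
theorem moore_eq_zero_of_comb_eq_zero [IsDomain R] {n : ℕ} {a : Fin n → R}
    {ε : Fin n → ZMod p} (hε : ε ≠ 0) (h : comb ε a = 0) : moore p a = 0 := by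
  refine Matrix.exists_mulVec_eq_zero_iff.mp ⟨fun i => algebraMap (ZMod p) R (ε i), ?_, ?_⟩
  · intro h0
    refine hε (funext fun i => (algebraMap (ZMod p) R).injective ?_)
    simpa using congrFun h0 i
  · funext j
    have := comb_pow ε a j
    rw [h, zero_pow (pow_ne_zero _ (Fact.out : p.Prime).ne_zero)] at this
    simp only [Matrix.mulVec, dotProduct, Matrix.of_apply, Pi.zero_apply, this, comb,
      Algebra.smul_def, mul_comm]

theorem moore_pow [Nontrivial R] {n : ℕ} (a : Fin n → R) (j : ℕ) :
    moore p (fun i => a i ^ p ^ j) = moore p a ^ p ^ j := by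
  have := charP_of_algebra_zmod p R
  exact map_moore (iterateFrobenius R p j) a

theorem comb_injective [IsDomain R] {n : ℕ} {a : Fin n → R} (h : moore p a ≠ 0) :
    Function.Injective fun ε : Fin n → ZMod p => comb ε a := by
  intro ε δ hεδ
  by_contra hne
  refine h (moore_eq_zero_of_comb_eq_zero (sub_ne_zero.mpr hne) ?_)
  rw [comb_sub_left]
  exact sub_eq_zero.mpr hεδ

theorem moore_insertNth_comb [IsDomain R] {m : ℕ} (i : Fin (m + 1)) (a : Fin m → R)
    (ε : Fin m → ZMod p) : moore p (i.insertNth (comb ε a) a : Fin (m + 1) → R) = 0 := by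
  refine moore_eq_zero_of_comb_eq_zero (ε := i.insertNth (-1) ε) (fun h => ?_) ?_
  · have := congrFun h i
    simp at this
  · rw [comb_insertNth]
    have : (i.insertNth (comb ε a) a : Fin (m + 1) → R) ∘ i.succAbove = a := by
      funext j; simp
    rw [this]
    simp

/-- As a polynomial in one of its entries, the Moore determinant has degree at most `p ^ m` and
vanishes on the span of the other `m` entries, so it is a multiple of the structural polynomial of
this span. -/
theorem moorePoly_eq [IsDomain R] {m : ℕ} (i : Fin (m + 1)) (a : Fin m → R)
    (h : moore p a ≠ 0) :
    moorePoly p i a = C ((-1) ^ (m + (i : ℕ)) * moore p a) *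
      ∏ ε : Fin m → ZMod p, (X - C (comb ε a)) := by
  have hcard : Fintype.card (Fin m → ZMod p) = p ^ m := by simp [ZMod.card]
  have hmonic : (∏ ε : Fin m → ZMod p, (X - C (comb ε a))).Monic := monic_prod_X_sub_C _ _
  have hdeg : (∏ ε : Fin m → ZMod p, (X - C (comb ε a))).natDegree = p ^ m := by
    rw [natDegree_prod_of_monic _ _ fun ε _ => monic_X_sub_C _]
    simp
  have hc : (∏ ε : Fin m → ZMod p, (X - C (comb ε a))).coeff (p ^ m) = 1 := by
    rw [← hdeg]; exact hmonic.coeff_natDegree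
  refine Polynomial.eq_of_degree_sub_lt_of_eval_index_eq (s := Finset.univ)
    (v := fun ε : Fin m → ZMod p => comb ε a) (comb_injective h).injOn ?_ ?_
  · rw [Finset.card_univ, hcard]
    rw [degree_lt_iff_coeff_zero]
    intro N hN
    rcases hN.eq_or_lt with rfl | hN
    · rw [coeff_sub, coeff_C_mul, hc, coeff_last_moorePoly, mul_one, sub_self]
    · rw [coeff_sub, coeff_C_mul, coeff_eq_zero_of_natDegree_lt (hdeg.trans_lt hN),
        coeff_eq_zero_of_natDegree_lt ((natDegree_moorePoly_le i a).trans_lt hN), mul_zero,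
        sub_self]
  · intro δ _
    rw [eval_moorePoly, moore_insertNth_comb, eval_mul, eval_prod,
      Finset.prod_eq_zero (Finset.mem_univ δ) (by simp), mul_zero]

/-- The product formula for Moore determinants, with respect to the `i`-th entry. -/
theorem moore_eq_prod [IsDomain R] {m : ℕ} (i : Fin (m + 1)) (a : Fin (m + 1) → R)
    (h : moore p (a ∘ i.succAbove) ≠ 0) :
    moore p a = (-1) ^ (m + (i : ℕ)) * moore p (a ∘ i.succAbove) *
      ∏ ε : Fin m → ZMod p, (a i - comb ε (a ∘ i.succAbove)) := by
  have h1 := congrArg (eval (a i)) (moorePoly_eq i (a ∘ i.succAbove) h)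
  rw [eval_moorePoly] at h1
  have h2 : (i.insertNth (a i) (a ∘ i.succAbove) : Fin (m + 1) → R) = a :=
    Fin.insertNth_self_removeNth i a
  rw [h2] at h1
  rw [h1, eval_mul, eval_C, eval_prod]
  simp

theorem comb_succAbove_ne_zero {m : ℕ} {M : Type*} [AddCommMonoid M] [Module (ZMod p) M]
    {a : Fin (m + 1) → M} (h : ∀ ε : Fin (m + 1) → ZMod p, ε ≠ 0 → comb ε a ≠ 0)
    (i : Fin (m + 1)) (ε : Fin m → ZMod p) (hε : ε ≠ 0) : comb ε (a ∘ i.succAbove) ≠ 0 := by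
  have := h (i.insertNth 0 ε) (fun h0 => hε (funext fun j => by
    simpa using congrFun h0 (i.succAbove j)))
  rwa [comb_insertNth, zero_smul, zero_add] at this

theorem sub_comb_eq {m : ℕ} {M : Type*} [AddCommGroup M] [Module (ZMod p) M]
    (a : Fin (m + 1) → M) (i : Fin (m + 1)) (ε : Fin m → ZMod p) :
    a i - comb ε (a ∘ i.succAbove) = comb (i.insertNth 1 (-ε) : Fin (m + 1) → ZMod p) a := by
  rw [comb_insertNth, one_smul, comb_neg_left, sub_eq_add_neg]

theorem insertNth_one_ne_zero {m : ℕ} (i : Fin (m + 1)) (ε : Fin m → ZMod p) :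
    (i.insertNth 1 ε : Fin (m + 1) → ZMod p) ≠ 0 := fun h => by
  simpa using congrFun h i

/-- The Moore determinant of linearly independent entries does not vanish, by induction with the
product formula. -/
theorem moore_ne_zero [IsDomain R] {n : ℕ} {a : Fin n → R}
    (h : ∀ ε : Fin n → ZMod p, ε ≠ 0 → comb ε a ≠ 0) : moore p a ≠ 0 := by
  induction n with
  | zero => simp [moore]
  | succ m ih =>
    have h0 := ih (comb_succAbove_ne_zero h 0)
    rw [moore_eq_prod 0 a h0]
    refine mul_ne_zero (mul_ne_zero (by simp) h0) (Finset.prod_ne_zero_iff.mpr fun ε _ => ?_)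
    rw [sub_comb_eq]
    exact h _ (insertNth_one_ne_zero _ _)

theorem moore_ne_zero_iff [IsDomain R] {n : ℕ} {a : Fin n → R} :
    moore p a ≠ 0 ↔ ∀ ε : Fin n → ZMod p, ε ≠ 0 → comb ε a ≠ 0 :=
  ⟨fun h _ hε h0 => h (moore_eq_zero_of_comb_eq_zero hε h0), moore_ne_zero⟩

theorem aeval_dickson {n : ℕ} (a : Fin n → R) (i : ℕ) :
    MvPolynomial.aeval a (dickson p n i) =
      (-1) ^ (n - i) * (∏ ε : Fin n → ZMod p, (X - C (comb ε a))).coeff (p ^ i) := by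
  have h : (structPoly p n).map (MvPolynomial.aeval a : MvPolynomial (Fin n) (ZMod p) →ₐ[ZMod p] R)
      = ∏ ε : Fin n → ZMod p, (X - C (comb ε a)) := by
    rw [structPoly, Polynomial.map_prod]
    refine Finset.prod_congr rfl fun ε _ => ?_
    rw [Polynomial.map_sub, map_X, map_C]
    simp [comb]
  rw [dickson, map_mul, ← h, coeff_map]
  simp

/-- The relation `∑ (-1)^(n-i) c_{n,i}(a) a_l^(p^i) = 0` satisfied by the entries of `a`. -/
theorem pow_eq_dickson [IsDomain R] {m : ℕ} (a : Fin (m + 1) → R) (h : moore p a ≠ 0) :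
    ∃ e : Fin m → R, ∀ l, a l ^ p ^ (m + 1) =
      MvPolynomial.aeval a (dickson p (m + 1) m) * a l ^ p ^ m +
        ∑ j : Fin m, e j * a l ^ p ^ (j : ℕ) := by
  have hP := moorePoly_eq (p := p) (Fin.last (m + 1)) a h
  set P := ∏ ε : Fin (m + 1) → ZMod p, (X - C (comb ε a)) with hPdef
  -- inserting the indeterminate at the end makes the sign trivial
  have hu : ((-1) ^ (m + 1 + ((Fin.last (m + 1) : Fin (m + 2)) : ℕ)) * moore p a : R)
      = moore p a := by
    rw [Fin.val_last, ← two_mul, pow_mul]; simp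
  rw [hu] at hP
  have hcoef : ∀ j : Fin (m + 2), (-1) ^ ((j : ℕ) + (Fin.last (m + 1) : Fin (m + 2))) *
      Matrix.det (Matrix.of fun r c : Fin (m + 1) => a c ^ p ^ (j.succAbove r : ℕ))
      = moore p a * P.coeff (p ^ (j : ℕ)) := fun j => by
    rw [← coeff_moorePoly, hP, coeff_C_mul]
  have hlast : P.coeff (p ^ (m + 1)) = 1 := by
    have := coeff_last_moorePoly (p := p) (Fin.last (m + 1)) a
    rw [hu, hP, coeff_C_mul] at this
    exact mul_left_cancel₀ h (this.trans (mul_one _).symm)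
  refine ⟨fun j => -P.coeff (p ^ (j : ℕ)), fun l => ?_⟩
  have h0 : moore p ((Fin.last (m + 1)).insertNth (a l) a : Fin (m + 2) → R) = 0 := by
    have := moore_insertNth_comb (p := p) (Fin.last (m + 1)) a (Pi.single l 1)
    rwa [comb_single] at this
  rw [moore_insertNth] at h0
  simp only [hcoef, mul_assoc] at h0
  rw [← Finset.mul_sum] at h0
  have h1 := (mul_eq_zero.mp h0).resolve_left h
  rw [Fin.sum_univ_castSucc, Fin.sum_univ_castSucc] at h1
  simp only [Fin.val_last, Fin.val_castSucc, hlast, one_mul] at h1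
  rw [aeval_dickson, Nat.add_sub_cancel_left, ← hPdef]
  simp only [neg_mul, Finset.sum_neg_distrib]
  linear_combination h1

/-- The power `Δ_m(a)^(p-1)` is, up to sign, the product of the nonzero elements of the span of `a`.
Comparison of the coefficients of `T` in the two expressions of the structural polynomial. -/
theorem moore_pow_eq_prod [IsDomain R] {m : ℕ} (a : Fin m → R) (h : moore p a ≠ 0) :
    moore p a ^ (p - 1) = (-1) ^ m *
      ∏ ε ∈ (Finset.univ : Finset (Fin m → ZMod p)).erase 0, -comb ε a := by
  have hp := (Fact.out : p.Prime)
  have hP := congrArg (fun f => f.coeff 1) (moorePoly_eq (p := p) 0 a h)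
  have hc := coeff_moorePoly (p := p) 0 a 0
  simp only [Fin.val_zero, pow_zero] at hc
  have hdet : Matrix.det (Matrix.of fun r c : Fin m => a c ^ p ^ ((0 : Fin (m + 1)).succAbove r : ℕ))
      = moore p a ^ p := by
    have := moore_pow (p := p) a 1
    rw [pow_one] at this
    rw [← this, moore]
    congr 1
    ext r c
    simp [← pow_mul, pow_succ']
  rw [hdet] at hc
  simp only [coeff_C_mul] at hP
  rw [hc, ← Finset.mul_prod_erase _ _ (Finset.mem_univ (0 : Fin m → ZMod p))] at hP
  have hz : comb (0 : Fin m → ZMod p) a = 0 := by simp [comb]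
  rw [hz, C_0, sub_zero, ← zero_add 1, coeff_X_mul, coeff_zero_eq_eval_zero, eval_prod] at hP
  simp only [eval_sub, eval_X, eval_C, zero_sub, Fin.val_zero, add_zero, pow_zero, one_mul] at hP
  refine mul_left_cancel₀ h ?_
  rw [← pow_succ', Nat.sub_add_cancel hp.one_lt.le, hP]
  ring

end Moore

/-! ### Dual tuples -/

section Dual

variable {p m : ℕ} {K : Type*} [Field K]

/-- Two tuples `u`, `Q` of length `m + 1` are dual if `∑ u_i Q_i^(p^j)` vanishes for `0 ≤ j < m` and
equals `(-1)^m` for `j = m`. -/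
def IsDual (p : ℕ) {m : ℕ} {K : Type*} [Field K] (u Q : Fin (m + 1) → K) : Prop :=
  ∀ j : Fin (m + 1), ∑ i, u i * Q i ^ p ^ (j : ℕ) = if j = Fin.last m then (-1) ^ m else 0

theorem eq_zero_of_sum_mul_pow_eq_zero {n : ℕ} {a w : Fin n → K} (h : moore p a ≠ 0)
    (hw : ∀ j : Fin n, ∑ i, w i * a i ^ p ^ (j : ℕ) = 0) : w = 0 := by
  refine Matrix.eq_zero_of_mulVec_eq_zero (M := mooreMatrix p a) h (funext fun j => ?_)
  simp only [Matrix.mulVec, dotProduct, mooreMatrix, Matrix.of_apply, Pi.zero_apply]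
  rw [← hw j]
  exact Finset.sum_congr rfl fun i _ => mul_comm _ _

theorem eq_of_sum_mul_pow_eq {n : ℕ} {a v w : Fin n → K} (h : moore p a ≠ 0)
    (hw : ∀ j : Fin n, ∑ i, v i * a i ^ p ^ (j : ℕ) = ∑ i, w i * a i ^ p ^ (j : ℕ)) : v = w := by
  refine sub_eq_zero.mp (eq_zero_of_sum_mul_pow_eq_zero h fun j => ?_)
  simp only [Pi.sub_apply, sub_mul, Finset.sum_sub_distrib, hw j, sub_self]

theorem sum_adjugate_mul_pow (a : Fin (m + 1) → K) (j r : Fin (m + 1)) :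
    ∑ i, (mooreMatrix p a).adjugate i r * a i ^ p ^ (j : ℕ) =
      if j = r then moore p a else 0 := by
  have := congrFun (congrFun (Matrix.mul_adjugate (mooreMatrix p a)) j) r
  rw [Matrix.mul_apply] at this
  simp only [mooreMatrix, Matrix.of_apply, Matrix.smul_apply, Matrix.one_apply, smul_eq_mul,
    mul_ite, mul_one, mul_zero] at this
  rw [moore, ← this]
  exact Finset.sum_congr rfl fun i _ => mul_comm _ _

theorem adjugate_mooreMatrix_last (a : Fin (m + 1) → K) (i : Fin (m + 1)) :
    (mooreMatrix p a).adjugate i (Fin.last m) =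
      (-1) ^ (m + (i : ℕ)) * moore p (a ∘ i.succAbove) := by
  rw [Matrix.adjugate_fin_succ_eq_det_submatrix, moore, Fin.val_last]
  congr 2
  ext r c
  simp [mooreMatrix]

/-- Cramer's rule: `Q` determines the tuple dual to it. -/
theorem isDual_iff {u Q : Fin (m + 1) → K} (h : moore p Q ≠ 0) :
    IsDual p u Q ↔ ∀ i, u i = (-1) ^ (i : ℕ) * moore p (Q ∘ i.succAbove) / moore p Q := by
  have hw : IsDual p (fun i : Fin (m + 1) =>
      (-1) ^ (i : ℕ) * moore p (Q ∘ i.succAbove) / moore p Q) Q := by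
    intro j
    have hj := sum_adjugate_mul_pow (p := p) Q j (Fin.last m)
    simp only [adjugate_mooreMatrix_last, pow_add, mul_assoc] at hj
    rw [← Finset.mul_sum] at hj
    have h1 : ((-1 : K) ^ m) * (-1) ^ m = 1 := by rw [← mul_pow]; simp
    simp only [div_mul_eq_mul_div, mul_assoc]
    rw [← Finset.sum_div, div_eq_iff h]
    split_ifs at hj ⊢ with hjl
    · rw [← hj, ← mul_assoc, h1, one_mul]
    · rw [zero_mul]
      simpa using hj
  constructor
  · intro hu i
    exact congrFun (eq_of_sum_mul_pow_eq h fun j => (hu j).trans (hw j).symm) i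
  · intro hu
    rwa [← funext hu] at hw

variable [Fact p.Prime] [Algebra (ZMod p) K]

theorem adjugate_mooreMatrix_zero (a : Fin (m + 1) → K) (i : Fin (m + 1)) :
    (mooreMatrix p a).adjugate i 0 =
      (-1) ^ (i : ℕ) * moore p (a ∘ i.succAbove) ^ p := by
  have := moore_pow (p := p) (a ∘ i.succAbove) 1
  rw [pow_one] at this
  rw [← this, Matrix.adjugate_fin_succ_eq_det_submatrix, moore, Fin.val_zero, zero_add]
  congr 2
  ext r c
  simp [mooreMatrix, ← pow_mul, pow_succ']

theorem neg_one_pow_pow_prime_pow (m j : ℕ) : ((-1 : K) ^ m) ^ p ^ j = (-1) ^ m := by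
  have := charP_of_algebra_zmod p K
  rw [pow_right_comm, neg_one_pow_char_pow]

/-- Conversely `u` determines the `p ^ m`-th powers of the entries of the tuple dual to it: raising
the relations between `u` and `Q` to powers of `p` gives linear relations between the conjugates of
`u` and the `p ^ m`-th powers. -/
theorem isDual_iff_pow {u Q : Fin (m + 1) → K} (h : moore p u ≠ 0) :
    IsDual p u Q ↔ ∀ i, Q i ^ p ^ m =
      (-1) ^ m * ((-1) ^ (i : ℕ) * moore p (u ∘ i.succAbove) ^ p) / moore p u := by
  have hp := (Fact.out : p.Prime)
  have hw : ∀ j : Fin (m + 1), ∑ i : Fin (m + 1), ((-1) ^ m * ((-1) ^ (i : ℕ) *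
      moore p (u ∘ i.succAbove) ^ p) / moore p u) * u i ^ p ^ (j : ℕ) =
      if j = 0 then (-1) ^ m else 0 := by
    intro j
    have hj := sum_adjugate_mul_pow (p := p) u j 0
    simp only [adjugate_mooreMatrix_zero] at hj
    simp only [div_mul_eq_mul_div, mul_assoc]
    rw [← Finset.sum_div, div_eq_iff h, ← Finset.mul_sum]
    simp only [mul_assoc] at hj
    rw [hj, mul_ite, mul_zero, ite_mul, zero_mul]
  have key : ∀ j : Fin (m + 1), (∑ i, u i * Q i ^ p ^ (j : ℕ)) ^ p ^ (m - j) =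
      ∑ i, Q i ^ p ^ m * u i ^ p ^ (m - j) := by
    intro j
    rw [sum_pow_prime_pow]
    refine Finset.sum_congr rfl fun i _ => ?_
    rw [mul_pow, ← pow_mul, ← pow_add, Nat.add_sub_cancel' (by omega), mul_comm]
  constructor
  · intro hu i
    refine congrFun (f := fun i => Q i ^ p ^ m) (g := fun i : Fin (m + 1) => (-1) ^ m *
      ((-1) ^ (i : ℕ) * moore p (u ∘ i.succAbove) ^ p) / moore p u)
      (eq_of_sum_mul_pow_eq h fun j => ?_) i
    rw [hw]
    have hk := key (Fin.rev j)
    rw [hu, Fin.val_rev] at hk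
    have h1 : m - (m + 1 - (j + 1)) = (j : ℕ) := by omega
    rw [h1] at hk
    rw [← hk]
    by_cases hj : j = 0
    · subst hj
      simp
    · rw [if_neg hj, if_neg, zero_pow (pow_ne_zero _ hp.ne_zero)]
      intro h0
      have := congrArg Fin.val h0
      rw [Fin.val_rev, Fin.val_last] at this
      exact hj (Fin.ext (show (j : ℕ) = 0 by omega))
  · intro hQ j
    have hk := key j
    simp only [hQ] at hk
    have hj := hw (Fin.rev j)
    rw [Fin.val_rev, show m + 1 - (j + 1) = m - (j : ℕ) by omega] at hj
    rw [hj] at hk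
    by_cases hjl : j = Fin.last m
    · subst hjl
      simpa using hk
    · rw [if_neg hjl]
      rw [if_neg] at hk
      · exact pow_eq_zero_iff (pow_ne_zero _ hp.ne_zero) |>.mp hk
      · intro h0
        have := congrArg Fin.val h0
        rw [Fin.val_rev] at this
        refine hjl (Fin.ext ?_)
        rw [Fin.val_last]
        have h2 : ((0 : Fin (m + 1)) : ℕ) = 0 := rfl
        omega

theorem IsDual.unique {u Q Q' : Fin (m + 1) → K} (h : moore p u ≠ 0) (hQ : IsDual p u Q)
    (hQ' : IsDual p u Q') : Q = Q' := by
  have := charP_of_algebra_zmod p K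
  funext i
  refine (iterateFrobenius K p m).injective ?_
  simp only [iterateFrobenius_def]
  rw [(isDual_iff_pow h).mp hQ, (isDual_iff_pow h).mp hQ']

/-- Contragredient base changes preserve duality. -/
theorem IsDual.baseChange {u Q : Fin (m + 1) → K} (h : IsDual p u Q)
    {M N : Matrix (Fin (m + 1)) (Fin (m + 1)) (ZMod p)} (hMN : Mᵀ * N = 1) :
    IsDual p (fun i => comb (M i) u) (fun i => comb (N i) Q) := by
  intro j
  rw [← h j]
  have h1 : ∀ a b, ∑ i, M i a * N i b = if a = b then 1 else 0 := fun a b => by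
    have := congrFun (congrFun hMN a) b
    rwa [Matrix.mul_apply, Matrix.one_apply] at this
  simp only [comb_pow]
  simp only [comb, Finset.sum_mul_sum, smul_mul_smul_comm]
  rw [Finset.sum_comm]
  refine Finset.sum_congr rfl fun a _ => ?_
  rw [Finset.sum_comm]
  simp only [← Finset.sum_smul, h1]
  simp

/-- A nonzero vector is a row of an invertible matrix, here a modification of the identity; `N` is
the contragredient matrix. -/
theorem exists_matrix_row {n : ℕ} (ε : Fin n → ZMod p) (hε : ε ≠ 0) :
    ∃ (i : Fin n) (M N : Matrix (Fin n) (Fin n) (ZMod p)), Mᵀ * N = 1 ∧ M i = ε := by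
  obtain ⟨i, hi⟩ := Function.ne_iff.mp hε
  refine ⟨i, (1 : Matrix (Fin n) (Fin n) (ZMod p)).updateRow i ε,
    ((1 : Matrix (Fin n) (Fin n) (ZMod p)).updateRow i ε)⁻¹ᵀ, ?_, ?_⟩
  · rw [← Matrix.transpose_mul, Matrix.nonsing_inv_mul, Matrix.transpose_one]
    have := Matrix.cramer_transpose_apply (1 : Matrix (Fin n) (Fin n) (ZMod p)) ε i
    rw [Matrix.transpose_one, Matrix.cramer_one] at this
    rw [← this]
    exact isUnit_iff_ne_zero.mpr hi
  · simp

theorem comb_comb {n : ℕ} {M : Type*} [AddCommMonoid M] [Module (ZMod p) M]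
    (ε : Fin n → ZMod p) (N : Matrix (Fin n) (Fin n) (ZMod p)) (a : Fin n → M) :
    comb ε (fun i => comb (N i) a) = comb (ε ᵥ* N) a := by
  simp only [comb, Matrix.vecMul, dotProduct, Finset.smul_sum, Finset.sum_smul, smul_smul]
  rw [Finset.sum_comm]

theorem vecMul_ne_zero {n : ℕ} {M N : Matrix (Fin n) (Fin n) (ZMod p)} (hMN : N * Mᵀ = 1)
    {ε : Fin n → ZMod p} (hε : ε ≠ 0) : ε ᵥ* N ≠ 0 := fun h => hε (by
  have : (ε ᵥ* N) ᵥ* Mᵀ = ε := by rw [Matrix.vecMul_vecMul, hMN, Matrix.vecMul_one]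
  rw [← this, h, Matrix.zero_vecMul])

/-- The relation of duality for the next exponent involves the Dickson invariant `c_{n,n-1}`. -/
theorem IsDual.sum_mul_pow_succ {u Q : Fin (m + 1) → K} (h : IsDual p u Q) (hQ : moore p Q ≠ 0) :
    ∑ i, u i * Q i ^ p ^ (m + 1) =
      (-1) ^ m * MvPolynomial.aeval Q (dickson p (m + 1) m) := by
  obtain ⟨e, he⟩ := pow_eq_dickson Q hQ
  have hl := h (Fin.last m)
  rw [if_pos rfl, Fin.val_last] at hl
  have h0 : ∀ j : Fin m, ∑ i, u i * Q i ^ p ^ (j : ℕ) = 0 := fun j => by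
    have := h j.castSucc
    rwa [if_neg (Fin.castSucc_lt_last j).ne] at this
  simp only [he, mul_add, Finset.sum_add_distrib, Finset.mul_sum]
  rw [Finset.sum_comm, ← hl, Finset.sum_mul]
  have h2 : ∑ j : Fin m, ∑ i, u i * (e j * Q i ^ p ^ (j : ℕ)) = 0 :=
    Finset.sum_eq_zero fun j _ => by
      simp only [mul_left_comm (u _) (e _)]
      rw [← Finset.mul_sum, h0, mul_zero]
  rw [h2, add_zero]
  exact Finset.sum_congr rfl fun i _ => by ring

section Derivation

variable {A : Type*} [CommRing A] [Algebra A K] (d : Derivation A K K)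

/-- Derivations are linear over `p`-th powers. -/
theorem derivation_pow_mul (y f : K) (l : ℕ) : d (y ^ p ^ (l + 1) * f) = y ^ p ^ (l + 1) * d f := by
  have := charP_of_algebra_zmod p K
  rw [Derivation.leibniz, Derivation.leibniz_pow, pow_succ, mul_nsmul]
  simp [nsmul_eq_mul, CharP.cast_eq_zero]

theorem iterate_derivation_pow_mul (y f : K) (l r : ℕ) :
    d^[r] (y ^ p ^ (l + 1) * f) = y ^ p ^ (l + 1) * d^[r] f := by
  induction r with
  | zero => rfl
  | succ r ih => rw [Function.iterate_succ_apply', ih, derivation_pow_mul,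
      Function.iterate_succ_apply']

theorem iterate_derivation_sum {ι : Type*} (s : Finset ι) (f : ι → K) (r : ℕ) :
    d^[r] (∑ i ∈ s, f i) = ∑ i ∈ s, d^[r] (f i) := by
  induction r with
  | zero => rfl
  | succ r ih => simp only [Function.iterate_succ_apply', ih, map_sum]

theorem iterate_derivation_smul (c : ZMod p) (x : K) (r : ℕ) : d^[r] (c • x) = c • d^[r] x := by
  induction r with
  | zero => rfl
  | succ r ih => rw [Function.iterate_succ_apply', ih, ZMod.map_smul, Function.iterate_succ_apply']

/-- Differentiating the relations between dual tuples `p - 1` times shows that the tuples of the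
`(p-1)`-th derivatives and of the `p`-th powers of the `u_i` satisfy proportional systems of linear
equations. -/
theorem IsDual.iterate_derivation {u Q : Fin (m + 1) → K} (h : IsDual p u Q)
    (hQ : moore p Q ≠ 0) (i : Fin (m + 1)) :
    d^[p - 1] (u i) = d^[p - 1] (MvPolynomial.aeval Q (dickson p (m + 1) m)) * u i ^ p := by
  have hp := (Fact.out : p.Prime)
  set c := MvPolynomial.aeval Q (dickson p (m + 1) m)
  have hQp : moore p (fun i => Q i ^ p ^ 1) ≠ 0 := by
    rw [moore_pow]
    exact pow_ne_zero _ hQ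
  have hpow : ∀ (j : ℕ) (i), (Q i ^ p ^ 1) ^ p ^ j = Q i ^ p ^ (j + 1) := fun j i => by
    rw [← pow_mul, ← pow_add, add_comm]
  have hsign : (-1 : K) ^ m = ((-1) ^ m) ^ p ^ (0 + 1) :=
    (neg_one_pow_pow_prime_pow m _).symm
  have hdsign : ∀ x : K, d^[p - 1] ((-1) ^ m * x) = (-1) ^ m * d^[p - 1] x := fun x => by
    rw [hsign, iterate_derivation_pow_mul]
  have hd0 : ∀ r, d^[r] (0 : K) = 0 := fun r => iterate_derivation_sum d ∅ (fun _ : ℕ => 0) r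
  have hd1 : d^[p - 1] (1 : K) = 0 := by
    -- at least one derivative is taken, since `p - 1 ≥ 1`
    obtain ⟨r, hr⟩ := Nat.exists_eq_succ_of_ne_zero (Nat.sub_ne_zero_of_lt hp.one_lt)
    rw [hr, Nat.succ_eq_add_one, Function.iterate_succ_apply, Derivation.map_one_eq_zero, hd0]
  refine congrFun (f := fun i => d^[p - 1] (u i)) (g := fun i => d^[p - 1] c * u i ^ p)
    (eq_of_sum_mul_pow_eq hQp fun j => ?_) i
  simp only [hpow]
  have hL : ∑ i, d^[p - 1] (u i) * Q i ^ p ^ ((j : ℕ) + 1)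
      = d^[p - 1] (∑ i, u i * Q i ^ p ^ ((j : ℕ) + 1)) := by
    rw [iterate_derivation_sum]
    refine Finset.sum_congr rfl fun i _ => ?_
    rw [mul_comm (u i), iterate_derivation_pow_mul, mul_comm]
  have hR : ∑ i, d^[p - 1] c * u i ^ p * Q i ^ p ^ ((j : ℕ) + 1)
      = d^[p - 1] c * (∑ i, u i * Q i ^ p ^ (j : ℕ)) ^ p ^ 1 := by
    rw [sum_pow_prime_pow, Finset.mul_sum]
    refine Finset.sum_congr rfl fun i _ => ?_
    rw [mul_pow, ← pow_mul, ← pow_add, pow_one, mul_assoc]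
  rw [hL, hR, h j]
  induction j using Fin.lastCases with
  | last =>
    rw [if_pos rfl, Fin.val_last, h.sum_mul_pow_succ hQ, hdsign]
    rw [neg_one_pow_pow_prime_pow, mul_comm]
  | cast j =>
    rw [if_neg (Fin.castSucc_lt_last j).ne, zero_pow (pow_ne_zero _ hp.ne_zero), mul_zero]
    have := h j.succ
    rw [Fin.val_succ] at this
    rw [Fin.val_castSucc, this]
    split_ifs
    · rw [← mul_one ((-1 : K) ^ m), hdsign, hd1, mul_zero]
    · exact hd0 _

end Derivation

end Dual

/-! ### Logarithmic forms and orders -/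

section Derivation

variable {k : Type*} [Field k]

/-- The derivation `d/dX` of `k(X)`. -/
def ratDeriv (k : Type*) [Field k] : Derivation k (RatFunc k) (RatFunc k) :=
  (coeffForm k).toLinearMap.compDer (D k (RatFunc k))

theorem ratDeriv_apply (f : RatFunc k) : ratDeriv k f = coeffForm k (D k (RatFunc k) f) := rfl

theorem ratDeriv_algebraMap (f : k[X]) :
    ratDeriv k (algebraMap k[X] (RatFunc k) f) = algebraMap k[X] (RatFunc k) (derivative f) := by
  have h : ∀ g : k[X], algebraMap k[X] (RatFunc k) g = aeval RatFunc.X g := fun g => by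
    rw [← RatFunc.algebraMap_X, aeval_algebraMap_apply, aeval_X_left_apply]
  have hX : ratDeriv k RatFunc.X = 1 := coeffForm_dX k
  rw [h, Derivation.map_aeval, hX, ← h, smul_eq_mul, mul_one]

theorem iterate_ratDeriv_algebraMap (f : k[X]) (r : ℕ) :
    (ratDeriv k)^[r] (algebraMap k[X] (RatFunc k) f) =
      algebraMap k[X] (RatFunc k) (derivative^[r] f) := by
  induction r with
  | zero => rfl
  | succ r ih => rw [Function.iterate_succ_apply', ih, ratDeriv_algebraMap,
      Function.iterate_succ_apply']

theorem isLogarithmic_iff_ratDeriv (ω : Form k) :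
    IsLogarithmic ω ↔ ∃ F : RatFunc k, F ≠ 0 ∧ coeffForm k ω = F⁻¹ * ratDeriv k F := by
  refine exists_congr fun F => and_congr_right fun _ => ?_
  rw [← (coeffForm k).injective.eq_iff, map_smul, smul_eq_mul, ratDeriv_apply]

/-- The linear polynomial `X - a` as a rational function. -/
def ratLin (a : k) : RatFunc k := algebraMap k[X] (RatFunc k) (X - C a)

theorem ratLin_ne_zero (a : k) : ratLin a ≠ 0 :=
  RatFunc.algebraMap_ne_zero (X_sub_C_ne_zero a)

theorem ratDeriv_ratLin (a : k) : ratDeriv k (ratLin a) = 1 := by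
  rw [ratLin, ratDeriv_algebraMap]
  simp

end Derivation

section Log

variable {p : ℕ} [Fact p.Prime] {k : Type*} [Field k] [Algebra (ZMod p) k]

/-- The `𝔽_p`-span of the functions `1 / (X - a)`: these are the sums of simple fractions with
residues in `𝔽_p`. -/
def logSpan (p : ℕ) [Fact p.Prime] (k : Type*) [Field k] [Algebra (ZMod p) k] :
    Submodule (ZMod p) (RatFunc k) :=
  Submodule.span (ZMod p) (Set.range fun a : k => (ratLin a)⁻¹)

theorem inv_ratLin_mem_logSpan (a : k) : (ratLin a)⁻¹ ∈ logSpan p k :=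
  Submodule.subset_span ⟨a, rfl⟩

theorem logDeriv_mul {F G : RatFunc k} (hF : F ≠ 0) (hG : G ≠ 0) :
    (F * G)⁻¹ * ratDeriv k (F * G) = F⁻¹ * ratDeriv k F + G⁻¹ * ratDeriv k G := by
  rw [Derivation.leibniz]
  simp only [smul_eq_mul]
  field_simp
  ring

theorem logDeriv_inv (F : RatFunc k) : F⁻¹⁻¹ * ratDeriv k F⁻¹ = -(F⁻¹ * ratDeriv k F) := by
  rcases eq_or_ne F 0 with rfl | hF
  · simp
  · rw [Derivation.leibniz_inv, smul_eq_mul]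
    field_simp

theorem logDeriv_algebraMap_mem [IsAlgClosed k] {f : k[X]} (hf : f ≠ 0) :
    (algebraMap k[X] (RatFunc k) f)⁻¹ * ratDeriv k (algebraMap k[X] (RatFunc k) f) ∈
      logSpan p k := by
  have key : ∀ s : Multiset k,
      (algebraMap k[X] (RatFunc k) (s.map fun a => X - C a).prod) ≠ 0 ∧
      (algebraMap k[X] (RatFunc k) (s.map fun a => X - C a).prod)⁻¹ *
        ratDeriv k (algebraMap k[X] (RatFunc k) (s.map fun a => X - C a).prod) ∈ logSpan p k := by
    intro s
    induction s using Multiset.induction_on with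
    | empty => simp
    | cons a s ih =>
      rw [Multiset.map_cons, Multiset.prod_cons, map_mul, ← ratLin]
      refine ⟨mul_ne_zero (ratLin_ne_zero a) ih.1, ?_⟩
      rw [logDeriv_mul (ratLin_ne_zero a) ih.1]
      refine add_mem ?_ ih.2
      rw [ratDeriv_ratLin, mul_one]
      exact inv_ratLin_mem_logSpan a
  have hs := (IsAlgClosed.splits f).eq_prod_roots
  have hc : algebraMap k[X] (RatFunc k) (C f.leadingCoeff) ≠ 0 :=
    RatFunc.algebraMap_ne_zero (C_ne_zero.mpr (leadingCoeff_ne_zero.mpr hf))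
  rw [hs, map_mul, logDeriv_mul hc (key _).1, ratDeriv_algebraMap, derivative_C, map_zero, mul_zero,
    zero_add]
  exact (key _).2

/-- A form `u dX` is logarithmic exactly when `u` is a sum of simple fractions with residues in
`𝔽_p`. -/
theorem isLogarithmic_iff [IsAlgClosed k] (ω : Form k) :
    IsLogarithmic ω ↔ coeffForm k ω ∈ logSpan p k := by
  rw [isLogarithmic_iff_ratDeriv]
  constructor
  · rintro ⟨F, hF, hω⟩
    have hn : algebraMap k[X] (RatFunc k) F.num ≠ 0 :=
      RatFunc.algebraMap_ne_zero (RatFunc.num_ne_zero hF)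
    have hd : algebraMap k[X] (RatFunc k) F.denom ≠ 0 :=
      RatFunc.algebraMap_ne_zero F.denom_ne_zero
    rw [hω, ← RatFunc.num_div_denom F, div_eq_mul_inv, logDeriv_mul hn (inv_ne_zero hd),
      logDeriv_inv]
    exact add_mem (logDeriv_algebraMap_mem (RatFunc.num_ne_zero hF))
      (neg_mem (logDeriv_algebraMap_mem F.denom_ne_zero))
  · intro h
    refine Submodule.span_induction (p := fun u _ => ∃ F : RatFunc k, F ≠ 0 ∧
      u = F⁻¹ * ratDeriv k F) ?_ ?_ ?_ ?_ h
    · rintro _ ⟨a, rfl⟩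
      exact ⟨ratLin a, ratLin_ne_zero a, by simp [ratDeriv_ratLin]⟩
    · exact ⟨1, one_ne_zero, by simp⟩
    · rintro x y _ _ ⟨F, hF, rfl⟩ ⟨G, hG, rfl⟩
      exact ⟨F * G, mul_ne_zero hF hG, (logDeriv_mul hF hG).symm⟩
    · rintro c x _ ⟨F, hF, rfl⟩
      have hpow : ∀ r : ℕ, (F ^ r)⁻¹ * ratDeriv k (F ^ r) = r • (F⁻¹ * ratDeriv k F) := by
        intro r
        induction r with
        | zero => simp
        | succ r ih => rw [pow_succ, logDeriv_mul (pow_ne_zero r hF) hF, ih, succ_nsmul]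
      refine ⟨F ^ c.val, pow_ne_zero _ hF, ?_⟩
      rw [hpow, ← Nat.cast_smul_eq_nsmul (ZMod p), ZMod.natCast_zmod_val]

theorem cast_factorial_pred_eq_neg_one (R : Type*) [CommRing R] [Algebra (ZMod p) R] :
    ((p - 1).factorial : R) = -1 := by
  have := congrArg (algebraMap (ZMod p) R) (ZMod.wilsons_lemma (p := p))
  simpa only [map_natCast, map_neg, map_one] using this

theorem neg_one_pow_pred (R : Type*) [CommRing R] [Nontrivial R] [Algebra (ZMod p) R] :
    (-1 : R) ^ (p - 1) = 1 := by
  have := charP_of_algebra_zmod p R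
  have h := neg_one_pow_char R p
  rw [← Nat.sub_add_cancel (Fact.out : p.Prime).one_lt.le, pow_succ] at h
  exact neg_injective ((mul_neg_one _).symm.trans h)

theorem iterate_ratDeriv_inv_ratLin (a : k) (r : ℕ) :
    (ratDeriv k)^[r] (ratLin a)⁻¹ = (-1) ^ r * (r.factorial : RatFunc k) *
      (ratLin a)⁻¹ ^ (r + 1) := by
  induction r with
  | zero => simp
  | succ r ih =>
    have h1 : ratDeriv k ((-1) ^ r * (r.factorial : RatFunc k)) = 0 := by
      have := (ratDeriv k).map_intCast ((-1) ^ r * (r.factorial : ℤ))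
      push_cast at this
      exact this
    rw [Function.iterate_succ_apply', ih, Derivation.leibniz, h1, Derivation.leibniz_pow,
      Derivation.leibniz_inv, ratDeriv_ratLin]
    simp only [smul_eq_mul, nsmul_eq_mul, Nat.factorial_succ]
    push_cast
    ring

/-- Jacobson's identity for logarithmic derivatives. -/
theorem iterate_ratDeriv_of_mem_logSpan {u : RatFunc k} (hu : u ∈ logSpan p k) :
    (ratDeriv k)^[p - 1] u = -u ^ p := by
  have hp := (Fact.out : p.Prime)
  have := charP_of_algebra_zmod p (RatFunc k)
  refine Submodule.span_induction (p := fun u _ => (ratDeriv k)^[p - 1] u = -u ^ p) ?_ ?_ ?_ ?_ hu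
  · rintro _ ⟨a, rfl⟩
    rw [iterate_ratDeriv_inv_ratLin, cast_factorial_pred_eq_neg_one, neg_one_pow_pred,
      Nat.sub_add_cancel hp.one_lt.le]
    ring
  · rw [zero_pow hp.ne_zero, neg_zero]
    exact iterate_derivation_sum (ratDeriv k) ∅ (fun _ : ℕ => 0) _
  · intro x y _ _ hx hy
    have h := iterate_derivation_sum (ratDeriv k) Finset.univ ![x, y] (p - 1)
    simp only [Fin.sum_univ_two, Matrix.cons_val_zero, Matrix.cons_val_one] at h
    rw [h, hx, hy, add_pow_char]
    ring
  · intro c x _ hx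
    have h2 := zmod_smul_pow c x 1
    rw [pow_one] at h2
    rw [iterate_derivation_smul, hx, h2, smul_neg]

/-- The roots of unity of order dividing `p - 1` lie in the prime field. -/
theorem mem_range_algebraMap_of_pow_eq_one {x : k} (hx : x ^ (p - 1) = 1) :
    ∃ c : ZMod p, algebraMap (ZMod p) k c = x := by
  have := charP_of_algebra_zmod p k
  have hp := (Fact.out : p.Prime)
  have hx' : x ^ p = x := by
    rw [← Nat.sub_add_cancel hp.one_lt.le, pow_succ, hx, one_mul]
  have hbot := (Subfield.mem_bot_iff_pow_eq_self k p).mpr hx'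
  rw [← ZMod.fieldRange_castHom_eq_bot p] at hbot
  obtain ⟨c, hc⟩ := hbot
  refine ⟨c, ?_⟩
  rw [← hc]
  exact RingHom.congr_fun (RingHom.ext_zmod _ _) c

/-- Evaluation of the `r`-th derivative of a multiple of `(X - a)^r`. -/
theorem eval_iterate_derivative_X_sub_C_pow_mul (a : k) (g : k[X]) (r : ℕ) :
    (derivative^[r] ((X - C a) ^ r * g)).eval a = r.factorial * g.eval a := by
  rw [iterate_derivative_mul, eval_finsetSum, Finset.sum_eq_single_of_mem 0 (by simp)]
  · rw [Nat.choose_zero_right, one_smul, eval_mul, Nat.sub_zero, iterate_derivative_X_sub_pow_self,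
      eval_natCast]
    rfl
  · intro b hb hb0
    rw [iterate_derivative_X_sub_pow, eval_smul, eval_mul, eval_smul, eval_pow,
      Nat.sub_sub_self (Finset.mem_range_succ_iff.mp hb), eval_sub, eval_X, eval_C, sub_self,
      zero_pow hb0, smul_zero, zero_mul, smul_zero]

/-- The partial fraction decomposition of the inverse of a product of distinct linear factors. -/
theorem inv_prod_eq_sum (b : k) (hb : b ≠ 0) (S : Finset k) (hS : S.Nonempty) [DecidableEq k] :
    (algebraMap k[X] (RatFunc k) (C b * ∏ a ∈ S, (X - C a)))⁻¹ =
      ∑ a ∈ S, algebraMap k[X] (RatFunc k) (C (b * ∏ j ∈ S.erase a, (a - j))⁻¹) *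
        (ratLin a)⁻¹ := by
  have h := congrArg (algebraMap k[X] (RatFunc k))
    (Lagrange.sum_basis (s := S) (v := (id : k → k)) Function.injective_id.injOn hS)
  have hB : algebraMap k[X] (RatFunc k) (C b * ∏ a ∈ S, (X - C a)) ≠ 0 :=
    RatFunc.algebraMap_ne_zero (mul_ne_zero (C_ne_zero.mpr hb)
      (Finset.prod_ne_zero_iff.mpr fun a _ => X_sub_C_ne_zero a))
  refine mul_right_cancel₀ hB ?_
  rw [inv_mul_cancel₀ hB, Finset.sum_mul, ← map_one (algebraMap k[X] (RatFunc k)), ← h, map_sum]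
  refine Finset.sum_congr rfl fun a ha => ?_
  rw [← Finset.mul_prod_erase _ _ ha, mul_left_comm, map_mul _ (X - C a), mul_assoc,
    ← mul_assoc (ratLin a)⁻¹, ← ratLin, inv_mul_cancel₀ (ratLin_ne_zero a), one_mul, ← map_mul]
  congr 1
  rw [Lagrange.basis]
  simp only [Lagrange.basisDivisor, Finset.prod_mul_distrib, id]
  rw [← mul_assoc, ← C_mul, _root_.mul_inv_rev, inv_mul_cancel_right₀ hb, ← map_prod,
    Finset.prod_inv_distrib]

/-- A partial converse of Jacobson's identity. Writing `u = B^(p-1) / B^p`, the hypothesis becomes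
`(B^(p-1))^(p-1) = -1`, whose value at a root `a` of `B` says that `B'(a)` is a nonzero element of
`𝔽_p`. -/
theorem mem_logSpan_of_iterate_ratDeriv [IsAlgClosed k] {B : k[X]} (hB : B ≠ 0)
    (h : (ratDeriv k)^[p - 1] (algebraMap k[X] (RatFunc k) B)⁻¹ =
      -(algebraMap k[X] (RatFunc k) B)⁻¹ ^ p) :
    (algebraMap k[X] (RatFunc k) B)⁻¹ ∈ logSpan p k := by
  classical
  have hp := (Fact.out : p.Prime)
  have hB' := RatFunc.algebraMap_ne_zero hB
  have h1 : derivative^[p - 1] (B ^ (p - 1)) = -1 := by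
    apply RatFunc.algebraMap_injective k
    have h2 := iterate_derivation_pow_mul (p := p) (ratDeriv k) (algebraMap k[X] (RatFunc k) B)
      (algebraMap k[X] (RatFunc k) B)⁻¹ 0 (p - 1)
    have h3 : algebraMap k[X] (RatFunc k) B ^ p ^ (0 + 1) * (algebraMap k[X] (RatFunc k) B)⁻¹ =
        algebraMap k[X] (RatFunc k) (B ^ (p - 1)) := by
      rw [zero_add, pow_one, map_pow]
      conv_lhs => rw [← Nat.sub_add_cancel hp.one_lt.le, pow_succ]
      rw [mul_inv_cancel_right₀ hB']
    rw [h3, h, iterate_ratDeriv_algebraMap, zero_add, pow_one, mul_neg, ← mul_pow,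
      mul_inv_cancel₀ hB', one_pow] at h2
    rw [h2, map_neg, map_one]
  -- `G.eval a` is `B'(a)`
  have hroot : ∀ a G, B = (X - C a) * G → G.eval a ^ (p - 1) = 1 := by
    intro a G hG
    have h2 := congrArg (eval a) h1
    rw [hG, mul_pow, eval_iterate_derivative_X_sub_C_pow_mul, cast_factorial_pred_eq_neg_one] at h2
    simpa using h2
  have hs := (IsAlgClosed.splits B).eq_prod_roots
  -- at a multiple root, `G.eval a` would be zero
  have hnd : B.roots.Nodup := by
    rw [Multiset.nodup_iff_count_le_one]
    intro a
    rw [count_roots]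
    by_contra! hlt
    obtain ⟨G, hG⟩ := (pow_dvd_pow (X - C a) hlt).trans (pow_rootMultiplicity_dvd B a)
    have := hroot a ((X - C a) * G) (by rw [hG]; ring)
    rw [eval_mul] at this
    simp [zero_pow (Nat.sub_ne_zero_of_lt hp.one_lt)] at this
  set S := B.roots.toFinset with hS
  have hBS : B = C B.leadingCoeff * ∏ a ∈ S, (X - C a) := by
    conv_lhs => rw [hs]
    rw [Finset.prod, hS, Multiset.toFinset_val, hnd.dedup]
  have hne : S.Nonempty := by
    rw [Finset.nonempty_iff_ne_empty]
    intro h0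
    rw [h0, Finset.prod_empty, mul_one] at hBS
    rw [hBS, ← C_pow] at h1
    obtain ⟨r, hr⟩ := Nat.exists_eq_succ_of_ne_zero (Nat.sub_ne_zero_of_lt hp.one_lt)
    rw [hr, Nat.succ_eq_add_one, Function.iterate_succ_apply, derivative_C,
      iterate_derivative_zero] at h1
    simp at h1
  have hb : B.leadingCoeff ≠ 0 := leadingCoeff_ne_zero.mpr hB
  rw [hBS, inv_prod_eq_sum _ hb S hne]
  refine sum_mem fun a ha => ?_
  obtain ⟨c, hc⟩ := mem_range_algebraMap_of_pow_eq_one (p := p)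
    (hroot a (C B.leadingCoeff * ∏ j ∈ S.erase a, (X - C j)) (by
      conv_lhs => rw [hBS, ← Finset.mul_prod_erase _ _ ha]
      ring))
  have : algebraMap k[X] (RatFunc k) (C (B.leadingCoeff * ∏ j ∈ S.erase a, (a - j))⁻¹) *
      (ratLin a)⁻¹ = c⁻¹ • (ratLin a)⁻¹ := by
    rw [Algebra.smul_def, IsScalarTower.algebraMap_apply (ZMod p) k[X] (RatFunc k),
      IsScalarTower.algebraMap_apply (ZMod p) k k[X], map_inv₀ (algebraMap (ZMod p) k), hc,
      Polynomial.algebraMap_eq]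
    simp [eval_prod]
  rw [this]
  exact Submodule.smul_mem _ _ (inv_ratLin_mem_logSpan a)

end Log

section Order

variable {k : Type*} [Field k]

/-- The order at a finite point may be computed from any fraction representing the form. -/
theorem orderAt_coe_eq {ω : Form k} {A B : k[X]} (hA : A ≠ 0) (hB : B ≠ 0)
    (h : coeffForm k ω = algebraMap k[X] (RatFunc k) A / algebraMap k[X] (RatFunc k) B) (a : k) :
    orderAt ω (a : OnePoint k) = (A.rootMultiplicity a : ℤ) - B.rootMultiplicity a := by
  have hu : coeffForm k ω ≠ 0 := by
    rw [h]
    exact div_ne_zero (RatFunc.algebraMap_ne_zero hA) (RatFunc.algebraMap_ne_zero hB)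
  have hn := RatFunc.num_ne_zero hu
  have hd := (coeffForm k ω).denom_ne_zero
  have h1 : (coeffForm k ω).num * B = A * (coeffForm k ω).denom :=
    (RatFunc.num_mul_eq_mul_denom_iff hB).mpr h
  have h2 := congrArg (rootMultiplicity a) h1
  rw [rootMultiplicity_mul (mul_ne_zero hn hB), rootMultiplicity_mul (mul_ne_zero hA hd)] at h2
  change (((coeffForm k ω).num.rootMultiplicity a : ℤ) - _) = _
  omega

/-- The order at infinity may be computed from any fraction representing the form. -/
theorem orderAt_infty_eq {ω : Form k} {A B : k[X]} (hA : A ≠ 0) (hB : B ≠ 0)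
    (h : coeffForm k ω = algebraMap k[X] (RatFunc k) A / algebraMap k[X] (RatFunc k) B) :
    orderAt ω OnePoint.infty = (B.natDegree : ℤ) - A.natDegree - 2 := by
  change -(coeffForm k ω).intDegree - 2 = _
  rw [h, RatFunc.intDegree_div (RatFunc.algebraMap_ne_zero hA) (RatFunc.algebraMap_ne_zero hB),
    RatFunc.intDegree_polynomial, RatFunc.intDegree_polynomial]
  ring

end Order

section Residues

variable {p : ℕ} [Fact p.Prime] {k : Type*} [Field k] [Algebra (ZMod p) k]

/-- A sum of simple fractions without zeros at finite distance is a constant divided by the product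
of the linear forms at its poles, and its order at infinity gives the number of poles. -/
theorem eq_div_prod_of_orderAt [IsAlgClosed k] {ω : Form k} (h : k →₀ ZMod p)
    (hω : coeffForm k ω = h.sum fun a c => c • (ratLin a)⁻¹) (hne : ω ≠ 0)
    (hz : ∀ a : k, orderAt ω (a : OnePoint k) ≤ 0) {N : ℕ}
    (hinf : orderAt ω OnePoint.infty = (N : ℤ) - 2) :
    h.support.card = N ∧ ∃ c : k, c ≠ 0 ∧ coeffForm k ω =
      algebraMap k[X] (RatFunc k) (C c) * ∏ a ∈ h.support, (ratLin a)⁻¹ := by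
  classical
  set S := h.support with hS
  set B : k[X] := ∏ a ∈ S, (X - C a) with hB
  set A : k[X] := ∑ a ∈ S, C (algebraMap (ZMod p) k (h a)) * ∏ b ∈ S.erase a, (X - C b) with hA
  have hB0 : B ≠ 0 := Finset.prod_ne_zero_iff.mpr fun a _ => X_sub_C_ne_zero a
  have hBm : algebraMap k[X] (RatFunc k) B = ∏ a ∈ S, ratLin a := by
    rw [hB, map_prod]; rfl
  have hAB : coeffForm k ω = algebraMap k[X] (RatFunc k) A / algebraMap k[X] (RatFunc k) B := by
    rw [eq_div_iff (RatFunc.algebraMap_ne_zero hB0), hω, Finsupp.sum, Finset.sum_mul, hA, map_sum]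
    refine Finset.sum_congr rfl fun a ha => ?_
    rw [hBm, ← Finset.mul_prod_erase _ _ ha, smul_mul_assoc, inv_mul_cancel_left₀
      (ratLin_ne_zero a), map_mul, map_prod, Algebra.smul_def,
      IsScalarTower.algebraMap_apply (ZMod p) k[X] (RatFunc k),
      IsScalarTower.algebraMap_apply (ZMod p) k k[X], Polynomial.algebraMap_eq]
    rfl
  have hA0 : A ≠ 0 := by
    intro h0
    rw [h0, map_zero, zero_div] at hAB
    exact hne ((map_eq_zero_iff _ (coeffForm k).injective).mp hAB)
  -- a root of `A` would be a zero of `ω` unless it is a pole, where `A` does not vanish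
  have hAroot : ∀ a, A.eval a ≠ 0 := by
    intro a ha0
    have hmA : 0 < A.rootMultiplicity a := (rootMultiplicity_pos hA0).mpr ha0
    have hord := hz a
    rw [orderAt_coe_eq hA0 hB0 hAB] at hord
    have hmB : 0 < B.rootMultiplicity a := by omega
    have hBa := (rootMultiplicity_pos hB0).mp hmB
    rw [IsRoot, hB, eval_prod, Finset.prod_eq_zero_iff] at hBa
    obtain ⟨b, hb, hab⟩ := hBa
    rw [eval_sub, eval_X, eval_C, sub_eq_zero] at hab
    subst hab
    rw [hA, eval_finsetSum, Finset.sum_eq_single_of_mem a hb] at ha0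
    · rw [eval_mul, eval_C, eval_prod, mul_eq_zero, Finset.prod_eq_zero_iff] at ha0
      rcases ha0 with h0 | ⟨b, hb, h0⟩
      · rw [map_eq_zero] at h0
        exact (Finsupp.mem_support_iff.mp hb) h0
      · rw [eval_sub, eval_X, eval_C, sub_eq_zero] at h0
        exact (Finset.ne_of_mem_erase hb) h0.symm
    · intro b hb' hba
      rw [eval_mul, eval_prod, Finset.prod_eq_zero (Finset.mem_erase.mpr ⟨hba.symm, hb⟩) (by simp),
        mul_zero]
  have hAdeg : A.degree = 0 := by
    by_contra hdeg
    obtain ⟨a, ha⟩ := IsAlgClosed.exists_root A hdeg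
    exact hAroot a ha
  obtain ⟨c, hc⟩ : ∃ c, A = C c := ⟨_, eq_C_of_degree_le_zero hAdeg.le⟩
  rw [hc] at hAB hA0
  rw [orderAt_infty_eq hA0 hB0 hAB, natDegree_C, hB, natDegree_prod_of_monic _ _
    fun a _ => monic_X_sub_C a] at hinf
  simp only [natDegree_X_sub_C, Finset.sum_const, smul_eq_mul, mul_one, Nat.cast_zero,
    sub_zero] at hinf
  refine ⟨by omega, c, fun h0 => hA0 (by rw [h0, C_0]), ?_⟩
  rw [hAB, hBm, div_eq_mul_inv, Finset.prod_inv_distrib]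

end Residues

/-! ### Forms attached to admissible tuples -/

section Forms

theorem numerator_eq {p m : ℕ} {k : Type*} [Field k] (Q : Fin (m + 1) → k[X]) (i : Fin (m + 1)) :
    numerator p Q i = (-1) ^ (i : ℕ) * moore p (Q ∘ i.succAbove) := by
  rw [numerator, hat_eq_succAbove]

theorem moore_algebraMap {p n : ℕ} {k : Type*} [Field k] (Q : Fin n → k[X]) :
    moore p (fun i => algebraMap k[X] (RatFunc k) (Q i)) =
      algebraMap k[X] (RatFunc k) (moore p Q) :=
  map_moore (algebraMap k[X] (RatFunc k)) Q

theorem moore_algebraMap_ne_zero {p n : ℕ} {k : Type*} [Field k] {Q : Fin n → k[X]}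
    (h : moore p Q ≠ 0) :
    moore p (fun i => algebraMap k[X] (RatFunc k) (Q i)) ≠ 0 := by
  rw [moore_algebraMap]
  exact RatFunc.algebraMap_ne_zero h

theorem isDual_algebraMap_iff {p m : ℕ} {k : Type*} [Field k]
    {u : Fin (m + 1) → RatFunc k} {Q : Fin (m + 1) → k[X]}
    (h : moore p Q ≠ 0) :
    IsDual p u (fun i => algebraMap k[X] (RatFunc k) (Q i)) ↔
      ∀ i, u i = coeffForm k (formOf p Q i) := by
  have hQ := moore_algebraMap_ne_zero h
  refine (isDual_iff hQ).trans (forall_congr' fun i => ?_)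
  have h1 : moore p ((fun i => algebraMap k[X] (RatFunc k) (Q i)) ∘ i.succAbove) =
      algebraMap k[X] (RatFunc k) (moore p (Q ∘ i.succAbove)) :=
    moore_algebraMap (Q ∘ i.succAbove)
  have h2 : coeffForm k (formOf p Q i) = (-1) ^ (i : ℕ) *
      algebraMap k[X] (RatFunc k) (moore p (Q ∘ i.succAbove)) /
        algebraMap k[X] (RatFunc k) (moore p Q) := by
    rw [formOf, coeffForm_smul_dX, numerator_eq, map_mul, map_pow, map_neg, map_one]
  rw [h1, h2, moore_algebraMap]

theorem isDual_formOf {p m : ℕ} {k : Type*} [Field k] {Q : Fin (m + 1) → k[X]}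
    (h : moore p Q ≠ 0) :
    IsDual p (fun i => coeffForm k (formOf p Q i))
      (fun i => algebraMap k[X] (RatFunc k) (Q i)) :=
  (isDual_algebraMap_iff h).mpr fun _ => rfl

variable {p : ℕ} [Fact p.Prime] {k : Type*} [Field k] [Algebra (ZMod p) k]

/-- The conditions defining a space `L_{N,n}`, for the span of a family of `n` forms. -/
theorem isSpaceL_span_iff {N n : ℕ} (ω : Fin n → Form k) :
    IsSpaceL p N n (Submodule.span (ZMod p) (Set.range ω)) ↔
      1 < N ∧ 0 < n ∧ ∀ ε : Fin n → ZMod p, ε ≠ 0 → comb ε ω ≠ 0 ∧ IsLogarithmic (comb ε ω) ∧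
        orderAt (comb ε ω) OnePoint.infty = (N : ℤ) - 2 ∧
        ∀ a : k, orderAt (comb ε ω) (a : OnePoint k) ≤ 0 := by
  have hmem : ∀ x, x ∈ Submodule.span (ZMod p) (Set.range ω) ↔ ∃ ε, comb ε ω = x := fun x =>
    Submodule.mem_span_range_iff_exists_fun (ZMod p)
  constructor
  · intro h
    have hli : LinearIndependent (ZMod p) ω := by
      rw [linearIndependent_iff_card_eq_finrank_span, Fintype.card_fin]
      exact h.finrank_eq.symm
    refine ⟨h.one_lt, h.pos, fun ε hε => ?_⟩
    have hne : comb ε ω ≠ 0 := fun h0 =>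
      hε (funext (Fintype.linearIndependent_iff.mp hli ε h0))
    have hm := (hmem _).mpr ⟨ε, rfl⟩
    exact ⟨hne, h.isLogarithmic _ hm hne, h.orderAt_infty _ hm hne, h.orderAt_coe _ hm hne⟩
  · rintro ⟨hN, hn, h⟩
    have hne : ∀ ε : Fin n → ZMod p, comb ε ω ≠ 0 → ε ≠ 0 := by
      rintro ε h0 rfl
      exact h0 (by simp [comb])
    refine ⟨hN, hn, ?_, ?_, ?_, ?_⟩
    · rw [finrank_span_eq_card, Fintype.card_fin]
      refine Fintype.linearIndependent_iff.mpr fun ε h0 i => ?_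
      by_contra hi
      exact (h ε fun h1 => hi (congrFun h1 i)).1 h0
    all_goals
      intro x hx h0
      obtain ⟨ε, rfl⟩ := (hmem x).mp hx
    · exact (h ε (hne ε h0)).2.1
    · exact (h ε (hne ε h0)).2.2.1
    · exact (h ε (hne ε h0)).2.2.2

theorem coeffForm_comb {n : ℕ} (ε : Fin n → ZMod p) (ω : Fin n → Form k) :
    coeffForm k (comb ε ω) = comb ε (fun i => coeffForm k (ω i)) :=
  map_comb (coeffForm k).toLinearMap.toAddMonoidHom ε ω

theorem algebraMap_comb {n : ℕ} (ε : Fin n → ZMod p) (Q : Fin n → k[X]) :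
    algebraMap k[X] (RatFunc k) (comb ε Q) = comb ε (fun i => algebraMap k[X] (RatFunc k) (Q i)) :=
  map_comb (algebraMap k[X] (RatFunc k)).toAddMonoidHom ε Q

/-- The leading coefficients of polynomials of degree `lam` are linearly independent over `𝔽_p`
exactly when no combination of the polynomials has smaller degree. -/
theorem isAdmissible_iff {lam n : ℕ} (Q : Fin n → k[X]) :
    IsAdmissible p lam Q ↔
      ∀ ε : Fin n → ZMod p, ε ≠ 0 → comb ε Q ≠ 0 ∧ (comb ε Q).natDegree = lam := by
  have hcoeff : ∀ (ε : Fin n → ZMod p) l, (comb ε Q).coeff l = comb ε (fun i => (Q i).coeff l) :=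
    fun ε l => by simp [comb, finsetSum_coeff]
  have key : (∀ i, (Q i).natDegree = lam) → ∀ ε : Fin n → ZMod p,
      (comb ε Q).coeff lam = comb ε (fun i => (Q i).leadingCoeff) := fun h ε => by
    rw [hcoeff]
    simp only [leadingCoeff, h]
  constructor
  · rintro ⟨h1, h2⟩ ε hε
    have h3 := moore_ne_zero_iff.mp h2 ε hε
    rw [← key h1] at h3
    refine ⟨fun h0 => h3 (by rw [h0, coeff_zero]), le_antisymm ?_ (le_natDegree_of_ne_zero h3)⟩
    exact natDegree_sum_le_of_forall_le _ _ fun i _ => (natDegree_smul_le _ _).trans (h1 i).le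
  · intro h
    have h1 : ∀ i, (Q i).natDegree = lam := fun i => by
      have := (h (Pi.single i 1) (by simp)).2
      rwa [comb_single] at this
    refine ⟨h1, moore_ne_zero fun ε hε => ?_⟩
    rw [← key h1]
    obtain ⟨h2, h3⟩ := h ε hε
    rw [← h3]
    exact leadingCoeff_ne_zero.mpr h2

theorem IsAdmissible.moore_ne_zero {lam n : ℕ} {Q : Fin n → k[X]} (h : IsAdmissible p lam Q) :
    moore p Q ≠ 0 :=
  LSpace.moore_ne_zero fun ε hε => ((isAdmissible_iff Q).mp h ε hε).1

/-- By the product formula, `P` is the product of `P_i` and of `p ^ m` combinations of the `Q_j`,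
up to sign. -/
theorem exists_moore_eq_numerator_mul {m lam : ℕ} {Q : Fin (m + 1) → k[X]}
    (h : IsAdmissible p lam Q) (i : Fin (m + 1)) :
    numerator p Q i ≠ 0 ∧
      ∃ B : k[X], B ≠ 0 ∧ B.natDegree = lam * p ^ m ∧ moore p Q = numerator p Q i * B := by
  have hQ := (isAdmissible_iff Q).mp h
  have h0 : moore p (Q ∘ i.succAbove) ≠ 0 := LSpace.moore_ne_zero
    (comb_succAbove_ne_zero (fun ε hε => (hQ ε hε).1) i)
  have hfac : ∀ ε : Fin m → ZMod p, Q i - comb ε (Q ∘ i.succAbove) ≠ 0 ∧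
      (Q i - comb ε (Q ∘ i.succAbove)).natDegree = lam := fun ε => by
    rw [sub_comb_eq]
    exact hQ _ (insertNth_one_ne_zero _ _)
  have hprod : ∏ ε : Fin m → ZMod p, (Q i - comb ε (Q ∘ i.succAbove)) ≠ 0 :=
    Finset.prod_ne_zero_iff.mpr fun ε _ => (hfac ε).1
  have hsign : ((-1 : k[X]) ^ m) = C ((-1) ^ m) := by simp
  rw [numerator_eq]
  refine ⟨mul_ne_zero (by simp) h0,
    (-1) ^ m * ∏ ε : Fin m → ZMod p, (Q i - comb ε (Q ∘ i.succAbove)),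
    mul_ne_zero (by simp) hprod, ?_, ?_⟩
  · rw [hsign, natDegree_C_mul (by simp), natDegree_prod _ _ fun ε _ => (hfac ε).1]
    simp only [(hfac _).2, Finset.sum_const, Finset.card_univ]
    simp [ZMod.card, mul_comm]
  · rw [moore_eq_prod i Q h0]
    ring

theorem coeffForm_formOf_eq {m lam : ℕ} {Q : Fin (m + 1) → k[X]} (h : IsAdmissible p lam Q)
    (i : Fin (m + 1)) :
    ∃ B : k[X], B ≠ 0 ∧ B.natDegree = lam * p ^ m ∧
      coeffForm k (formOf p Q i) = (algebraMap k[X] (RatFunc k) B)⁻¹ := by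
  obtain ⟨hP, B, hB, hdeg, hBP⟩ := exists_moore_eq_numerator_mul h i
  refine ⟨B, hB, hdeg, ?_⟩
  rw [formOf, coeffForm_smul_dX, hBP, map_mul,
    div_mul_cancel_left₀ (RatFunc.algebraMap_ne_zero hP)]

/-- Every nonzero combination of the forms attached to an admissible tuple is one of the forms
attached to another admissible tuple, obtained by a base change. -/
theorem exists_isAdmissible_comb_formOf {m lam : ℕ} {Q : Fin (m + 1) → k[X]}
    (h : IsAdmissible p lam Q) (ε : Fin (m + 1) → ZMod p) (hε : ε ≠ 0) :
    ∃ (Q' : Fin (m + 1) → k[X]) (i : Fin (m + 1)), IsAdmissible p lam Q' ∧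
      coeffForm k (comb ε (formOf p Q)) = coeffForm k (formOf p Q' i) := by
  obtain ⟨i, M, N, hMN, hi⟩ := exists_matrix_row ε hε
  have hNM : N * Mᵀ = 1 := mul_eq_one_comm.mp hMN
  have h' : IsAdmissible p lam (fun i => comb (N i) Q) := by
    rw [isAdmissible_iff] at h ⊢
    intro δ hδ
    rw [comb_comb]
    exact h _ (vecMul_ne_zero hNM hδ)
  refine ⟨_, i, h', ?_⟩
  have hd := (isDual_formOf h.moore_ne_zero).baseChange hMN
  simp only [← algebraMap_comb] at hd
  rw [← (isDual_algebraMap_iff h'.moore_ne_zero).mp hd i, coeffForm_comb, hi]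

/-- The `(p-1)`-th derivatives of the combinations of the `P_i / P` are governed by the
`(p-1)`-th derivative of `c_{n,n-1}(Q)`. -/
theorem iterate_ratDeriv_comb_formOf {m : ℕ} {Q : Fin (m + 1) → k[X]} (h : moore p Q ≠ 0)
    (ε : Fin (m + 1) → ZMod p) :
    (ratDeriv k)^[p - 1] (coeffForm k (comb ε (formOf p Q))) =
      algebraMap k[X] (RatFunc k)
        (derivative^[p - 1] (MvPolynomial.aeval Q (dickson p (m + 1) m))) *
        coeffForm k (comb ε (formOf p Q)) ^ p := by
  have hQ := moore_algebraMap_ne_zero h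
  have hd := (isDual_formOf h).iterate_derivation (ratDeriv k) hQ
  have hc : MvPolynomial.aeval (fun i => algebraMap k[X] (RatFunc k) (Q i)) (dickson p (m + 1) m)
      = algebraMap k[X] (RatFunc k) (MvPolynomial.aeval Q (dickson p (m + 1) m)) :=
    MvPolynomial.aeval_algebraMap_apply _ _ _
  rw [hc, iterate_ratDeriv_algebraMap] at hd
  rw [coeffForm_comb]
  have hpow := comb_pow ε (fun i => coeffForm k (formOf p Q i)) 1
  rw [pow_one] at hpow
  rw [hpow, comb, iterate_derivation_sum, comb, Finset.mul_sum]
  refine Finset.sum_congr rfl fun i _ => ?_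
  rw [iterate_derivation_smul, hd, mul_smul_comm]

/-- If a form attached to an admissible tuple is logarithmic, then the tuple satisfies the
condition on `c_{n,n-1}(Q)`. -/
theorem dicksonCondition_of_isLogarithmic [IsAlgClosed k] {m : ℕ} {Q : Fin (m + 1) → k[X]}
    (h : moore p Q ≠ 0) (ε : Fin (m + 1) → ZMod p) (hne : comb ε (formOf p Q) ≠ 0)
    (hlog : IsLogarithmic (comb ε (formOf p Q))) : DicksonCondition p Q := by
  have h1 := iterate_ratDeriv_of_mem_logSpan ((isLogarithmic_iff (p := p) _).mp hlog)
  rw [iterate_ratDeriv_comb_formOf h, ← neg_one_mul] at h1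
  have hu : coeffForm k (comb ε (formOf p Q)) ≠ 0 := fun h0 =>
    hne ((map_eq_zero_iff _ (coeffForm k).injective).mp h0)
  have h2 := mul_right_cancel₀ (pow_ne_zero p hu) h1
  apply RatFunc.algebraMap_injective k
  rw [map_neg, map_one, ← h2]
  rfl

/-- By base change it suffices to consider the form `P_i / P dX` of an admissible tuple, which is
the inverse of a polynomial of degree `lam * p ^ m`. -/
theorem isSpaceL_of_dicksonCondition [IsAlgClosed k] {m lam : ℕ} {Q : Fin (m + 1) → k[X]}
    (hN : 1 < lam * p ^ m) (h : IsAdmissible p lam Q) (hD : DicksonCondition p Q) :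
    IsSpaceL p (lam * p ^ m) (m + 1) (Submodule.span (ZMod p) (Set.range (formOf p Q))) := by
  rw [isSpaceL_span_iff]
  refine ⟨hN, m.succ_pos, fun ε hε => ?_⟩
  obtain ⟨Q', i, hQ', hi⟩ := exists_isAdmissible_comb_formOf h ε hε
  obtain ⟨B, hB, hdeg, hB'⟩ := coeffForm_formOf_eq hQ' i
  rw [← hi] at hB'
  have hdiv : coeffForm k (comb ε (formOf p Q)) =
      algebraMap k[X] (RatFunc k) 1 / algebraMap k[X] (RatFunc k) B := by
    rw [hB', map_one, one_div]
  refine ⟨fun h0 => ?_, ?_, ?_, fun a => ?_⟩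
  · rw [h0, map_zero] at hB'
    exact inv_ne_zero (RatFunc.algebraMap_ne_zero hB) hB'.symm
  · rw [isLogarithmic_iff (p := p), hB']
    refine mem_logSpan_of_iterate_ratDeriv hB ?_
    rw [← hB', iterate_ratDeriv_comb_formOf h.moore_ne_zero]
    have : derivative^[p - 1] (MvPolynomial.aeval Q (dickson p (m + 1) m)) = -1 := hD
    rw [this, map_neg, map_one, neg_one_mul]
  · rw [orderAt_infty_eq one_ne_zero hB hdiv, natDegree_one, hdeg, Nat.cast_zero, sub_zero]
  · rw [orderAt_coe_eq one_ne_zero hB hdiv, ← C_1, rootMultiplicity_C]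
    omega

end Forms

/-! ### Poles and the dual tuple -/

section Residues

theorem exists_prod_eq_C_mul {k : Type*} [Field k] {ι : Type*} (s : Finset ι) (f g : ι → RatFunc k)
    (h : ∀ i ∈ s, ∃ c : k, c ≠ 0 ∧ f i = algebraMap k[X] (RatFunc k) (C c) * g i) :
    ∃ c : k, c ≠ 0 ∧ ∏ i ∈ s, f i = algebraMap k[X] (RatFunc k) (C c) * ∏ i ∈ s, g i := by
  choose! c hc hf using h
  refine ⟨∏ i ∈ s, c i, Finset.prod_ne_zero_iff.mpr hc, ?_⟩
  rw [Finset.prod_congr rfl hf, Finset.prod_mul_distrib, map_prod, map_prod]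

variable {p : ℕ} [Fact p.Prime]

/-- An affine function on `𝔽_p^m` and its linear part have equally many non-zeros, unless the
linear part vanishes. -/
theorem card_affine_ne_zero {m : ℕ} (x : ZMod p) (y : Fin m → ZMod p) (h : y = 0 → x ≠ 0) :
    (Finset.univ.filter fun ε : Fin m → ZMod p => x + ∑ j, ε j * y j ≠ 0).card =
      (Finset.univ.filter fun ε : Fin m → ZMod p => ∑ j, ε j * y j ≠ 0).card +
        if y = 0 then p ^ m else 0 := by
  split_ifs with hy
  · subst hy
    simp [h rfl, ZMod.card]
  · obtain ⟨j, hj⟩ := Function.ne_iff.mp hy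
    have hj : y j ≠ 0 := hj
    rw [add_zero]
    refine Finset.card_bij' (fun ε _ => ε + Pi.single j (x / y j))
      (fun ε _ => ε - Pi.single j (x / y j)) ?_ ?_ ?_ ?_
    · intro ε hε
      simp only [Finset.mem_filter, Finset.mem_univ, true_and] at hε ⊢
      rw [add_comm] at hε
      simpa [add_mul, Finset.sum_add_distrib, Pi.single_apply, div_mul_cancel₀ _ hj] using hε
    · intro ε hε
      simp only [Finset.mem_filter, Finset.mem_univ, true_and] at hε ⊢
      simpa [sub_mul, Finset.sum_sub_distrib, Pi.single_apply, div_mul_cancel₀ _ hj] using hε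
    · intro ε _
      simp
    · intro ε _
      simp

theorem comb_finsupp_apply {k : Type*} {n : ℕ} (ε : Fin n → ZMod p) (h : Fin n → k →₀ ZMod p)
    (a : k) :
    comb ε h a = ∑ i, ε i * h i a := by
  simp [comb, Finsupp.finsetSum_apply]

theorem prod_support_comb {k : Type*} {n : ℕ} {S : Finset k} {h : Fin n → k →₀ ZMod p}
    (hS : ∀ i, (h i).support ⊆ S) (ε : Fin n → ZMod p) {M : Type*} [CommMonoid M] (f : k → M) :
    ∏ a ∈ (comb ε h).support, f a = ∏ a ∈ S, if comb ε h a ≠ 0 then f a else 1 := by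
  rw [← Finset.prod_filter]
  refine Finset.prod_congr (Finset.ext fun a => ?_) fun _ _ => rfl
  rw [Finset.mem_filter, Finsupp.mem_support_iff]
  refine ⟨fun ha => ⟨?_, ha⟩, fun ha => ha.2⟩
  by_contra haS
  refine ha ?_
  rw [comb_finsupp_apply]
  refine Finset.sum_eq_zero fun i _ => ?_
  rw [Finsupp.notMem_support_iff.mp fun hm => haS (hS i hm), mul_zero]

theorem prod_prod_support_comb {k : Type*} {n : ℕ} {ι : Type*} (s : Finset ι)
    (e : ι → Fin n → ZMod p) {S : Finset k} {h : Fin n → k →₀ ZMod p}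
    (hS : ∀ i, (h i).support ⊆ S) {M : Type*} [CommMonoid M] (f : k → M) :
    ∏ i ∈ s, ∏ a ∈ (comb (e i) h).support, f a =
      ∏ a ∈ S, f a ^ (s.filter fun i => comb (e i) h a ≠ 0).card := by
  simp only [prod_support_comb hS]
  rw [Finset.prod_comm]
  refine Finset.prod_congr rfl fun a _ => ?_
  rw [← Finset.prod_filter, Finset.prod_const]

theorem sum_card_support_comb {k : Type*} {n : ℕ} {ι : Type*} (s : Finset ι)
    (e : ι → Fin n → ZMod p) {S : Finset k} {h : Fin n → k →₀ ZMod p}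
    (hS : ∀ i, (h i).support ⊆ S) :
    ∑ i ∈ s, (comb (e i) h).support.card =
      ∑ a ∈ S, (s.filter fun i => comb (e i) h a ≠ 0).card := by
  -- the product formula for the constant function `2` compares powers of `2`
  have := prod_prod_support_comb s e hS (fun _ => 2)
  simp only [Finset.prod_const, Finset.prod_pow_eq_pow_sum] at this
  exact Nat.pow_right_injective le_rfl this

variable {k : Type*} [Field k] [Algebra (ZMod p) k]

/-- The entry of the dual tuple with index `i` is, up to a constant, the product of the linear
forms at the points which are poles of `u_i` only. Indeed its `p ^ m`-th power is a quotient of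
products of combinations of the `u_j`, in which a point that is a pole of some other `u_j`
contributes equally to both products. -/
theorem exists_dual_entry [IsAlgClosed k] {m lam : ℕ} (h : Fin (m + 1) → k →₀ ZMod p)
    (u : Fin (m + 1) → RatFunc k)
    (hu : ∀ ε : Fin (m + 1) → ZMod p, ε ≠ 0 → ∃ c : k, c ≠ 0 ∧ comb ε u =
      algebraMap k[X] (RatFunc k) (C c) * ∏ a ∈ (comb ε h).support, (ratLin a)⁻¹)
    (hN : ∀ ε : Fin (m + 1) → ZMod p, ε ≠ 0 → (comb ε h).support.card = lam * p ^ m)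
    (i : Fin (m + 1)) :
    ∃ q : k[X], q ≠ 0 ∧ q.natDegree = lam ∧ algebraMap k[X] (RatFunc k) q ^ p ^ m =
      (-1) ^ m * ((-1) ^ (i : ℕ) * moore p (u ∘ i.succAbove) ^ p) / moore p u := by
  classical
  have hp := (Fact.out : p.Prime)
  have hpm : 0 < p ^ m := pow_pos hp.pos m
  set S : Finset k := Finset.univ.biUnion fun i => (h i).support with hSdef
  have hS : ∀ i, (h i).support ⊆ S := fun i =>
    Finset.subset_biUnion_of_mem (fun i => (h i).support) (Finset.mem_univ i)
  have hune : ∀ ε : Fin (m + 1) → ZMod p, ε ≠ 0 → comb ε u ≠ 0 := fun ε hε => by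
    obtain ⟨c, hc, hε'⟩ := hu ε hε
    rw [hε']
    exact mul_ne_zero (RatFunc.algebraMap_ne_zero (C_ne_zero.mpr hc))
      (Finset.prod_ne_zero_iff.mpr fun a _ => inv_ne_zero (ratLin_ne_zero a))
  have hm' : moore p (u ∘ i.succAbove) ≠ 0 :=
    LSpace.moore_ne_zero (comb_succAbove_ne_zero hune i)
  set Z := (Finset.univ : Finset (Fin m → ZMod p)).erase 0 with hZ
  -- the two products of combinations of the `u_j`, and their exponents at a point `a`
  set e1 : (Fin m → ZMod p) → Fin (m + 1) → ZMod p := fun ε => i.insertNth 1 ε with he1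
  set e0 : (Fin m → ZMod p) → Fin (m + 1) → ZMod p := fun ε => i.insertNth 0 ε with he0
  have he1ne : ∀ ε, e1 ε ≠ 0 := fun ε => insertNth_one_ne_zero i ε
  have he0ne : ∀ ε ∈ Z, e0 ε ≠ 0 := fun ε hε h0 => (Finset.mem_erase.mp hε).1 (funext fun j => by
    simpa [he0] using congrFun h0 (i.succAbove j))
  set n1 : k → ℕ := fun a => (Finset.univ.filter fun ε => comb (e1 ε) h a ≠ 0).card with hn1
  set n0 : k → ℕ := fun a => (Z.filter fun ε => comb (e0 ε) h a ≠ 0).card with hn0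
  -- `T` is the set of poles of `u_i` at which no other `u_j` has a pole
  set T : Finset k := S.filter fun a => (fun j => h (i.succAbove j) a) = 0 with hT
  have hcount : ∀ a ∈ S, n1 a = n0 a + if a ∈ T then p ^ m else 0 := by
    intro a ha
    have hxy : (fun j => h (i.succAbove j) a) = 0 → h i a ≠ 0 := by
      intro hy hx
      obtain ⟨j, _, hj⟩ := Finset.mem_biUnion.mp ha
      refine Finsupp.mem_support_iff.mp hj ?_
      rcases Fin.eq_self_or_eq_succAbove i j with rfl | ⟨l, rfl⟩
      · exact hx
      · exact congrFun hy l
    have hc := card_affine_ne_zero (h i a) (fun j => h (i.succAbove j) a) hxy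
    have h1 : n1 a = (Finset.univ.filter fun ε : Fin m → ZMod p =>
        h i a + ∑ j, ε j * h (i.succAbove j) a ≠ 0).card := by
      refine congrArg Finset.card (Finset.ext fun ε => ?_)
      simp [he1, comb_finsupp_apply, Fin.sum_univ_succAbove _ i]
    rw [h1, hc]
    congr 1
    · refine congrArg Finset.card (Finset.ext fun ε => ?_)
      simp only [hZ, he0, Finset.mem_filter, Finset.mem_erase, Finset.mem_univ, true_and,
        and_true, comb_finsupp_apply, Fin.sum_univ_succAbove _ i, Fin.insertNth_apply_same,
        Fin.insertNth_apply_succAbove, zero_mul, zero_add, ne_eq]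
      refine ⟨fun hε => ⟨?_, hε⟩, fun hε => hε.2⟩
      rintro rfl
      simp at hε
    · simp [hT, ha]
  have hTS : T ⊆ S := Finset.filter_subset _ _
  -- both products are compared by their degrees: each factor has `lam * p ^ m` poles
  have hcardT : T.card = lam := by
    have c1 := sum_card_support_comb Finset.univ e1 hS
    have c0 := sum_card_support_comb Z e0 hS
    rw [Finset.sum_congr rfl fun ε _ => hN (e1 ε) (he1ne ε), Finset.sum_congr rfl hcount,
      Finset.sum_add_distrib, ← Finset.sum_filter, Finset.filter_mem_eq_inter,
      Finset.inter_eq_right.mpr hTS] at c1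
    rw [Finset.sum_congr rfl fun ε hε => hN (e0 ε) (he0ne ε hε)] at c0
    rw [← c0, Finset.sum_const, Finset.sum_const, Finset.sum_const,
      ← Finset.card_erase_add_one (Finset.mem_univ (0 : Fin m → ZMod p)), add_smul, one_smul] at c1
    exact (Nat.eq_of_mul_eq_mul_right hpm (Nat.add_left_cancel c1)).symm
  obtain ⟨c1, hc1, hprod1⟩ := exists_prod_eq_C_mul Finset.univ (fun ε => comb (e1 ε) u) _
    fun ε _ => hu (e1 ε) (he1ne ε)
  obtain ⟨c0, hc0, hprod0⟩ := exists_prod_eq_C_mul Z (fun ε => comb (e0 ε) u) _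
    fun ε hε => hu (e0 ε) (he0ne ε hε)
  rw [prod_prod_support_comb _ _ hS] at hprod1 hprod0
  have hsplit : ∏ a ∈ S, (ratLin a)⁻¹ ^ n1 a =
      (∏ a ∈ S, (ratLin a)⁻¹ ^ n0 a) * ((∏ a ∈ T, ratLin a) ^ p ^ m)⁻¹ := by
    have : ∏ a ∈ S, (ratLin a)⁻¹ ^ n1 a =
        ∏ a ∈ S, (ratLin a)⁻¹ ^ n0 a * if a ∈ T then (ratLin a)⁻¹ ^ p ^ m else 1 :=
      Finset.prod_congr rfl fun a ha => by
        rw [hcount a ha, pow_add]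
        split_ifs <;> simp
    rw [this, Finset.prod_mul_distrib, ← Finset.prod_filter, Finset.filter_mem_eq_inter,
      Finset.inter_eq_right.mpr hTS, Finset.prod_pow, Finset.prod_inv_distrib, inv_pow]
  have hden : ∏ ε : Fin m → ZMod p, (u i - comb ε (u ∘ i.succAbove)) =
      ∏ ε : Fin m → ZMod p, comb (e1 ε) u := by
    rw [← Equiv.prod_comp (Equiv.neg (Fin m → ZMod p))]
    exact Finset.prod_congr rfl fun ε _ => by rw [sub_comb_eq, Equiv.neg_apply, neg_neg]
  have hnum : moore p (u ∘ i.succAbove) ^ (p - 1) =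
      (-1) ^ m * ((-1) ^ Z.card * ∏ ε ∈ Z, comb (e0 ε) u) := by
    rw [moore_pow_eq_prod _ hm', Finset.prod_neg]
    congr 2
    exact Finset.prod_congr rfl fun ε _ => by rw [he0, comb_insertNth, zero_smul, zero_add]
  have hmpow : moore p (u ∘ i.succAbove) ^ p =
      moore p (u ∘ i.succAbove) ^ (p - 1) * moore p (u ∘ i.succAbove) := by
    rw [← pow_succ, Nat.sub_add_cancel hp.one_lt.le]
  -- the constant factor of the quotient of the two products is a `p ^ m`-th power in `k`
  obtain ⟨b, hb⟩ := IsAlgClosed.exists_pow_nat_eq ((-1) ^ m * (-1) ^ Z.card * c0 / c1) hpm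
  have hb0 : b ≠ 0 := by
    rintro rfl
    rw [zero_pow hpm.ne', eq_comm, div_eq_zero_iff] at hb
    rcases hb with hb | hb
    · exact mul_ne_zero (mul_ne_zero (by simp) (by simp)) hc0 hb
    · exact hc1 hb
  have hmon : (∏ a ∈ T, (X - C a)).Monic := monic_prod_of_monic _ _ fun a _ => monic_X_sub_C a
  refine ⟨C b * ∏ a ∈ T, (X - C a), mul_ne_zero (C_ne_zero.mpr hb0) hmon.ne_zero, ?_, ?_⟩
  · rw [natDegree_C_mul hb0, natDegree_prod_of_monic _ _ fun a _ => monic_X_sub_C a]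
    simpa using hcardT
  · have hL : algebraMap k[X] (RatFunc k) (C b * ∏ a ∈ T, (X - C a)) ^ p ^ m =
        algebraMap k[X] (RatFunc k) (C (b ^ p ^ m)) * (∏ a ∈ T, ratLin a) ^ p ^ m := by
      rw [map_mul, mul_pow, C_pow, map_pow, map_prod]
      rfl
    have hWne : ∏ a ∈ S, (ratLin a)⁻¹ ^ n0 a ≠ 0 :=
      Finset.prod_ne_zero_iff.mpr fun a _ => pow_ne_zero _ (inv_ne_zero (ratLin_ne_zero a))
    have hTne : (∏ a ∈ T, ratLin a) ^ p ^ m ≠ 0 :=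
      pow_ne_zero _ (Finset.prod_ne_zero_iff.mpr fun a _ => ratLin_ne_zero a)
    have hCdiv : algebraMap k[X] (RatFunc k) (C ((-1) ^ m * (-1) ^ Z.card * c0 / c1)) =
        (-1) ^ m * (-1) ^ Z.card * algebraMap k[X] (RatFunc k) (C c0) /
          algebraMap k[X] (RatFunc k) (C c1) := by
      rw [eq_div_iff (RatFunc.algebraMap_ne_zero (C_ne_zero.mpr hc1)), ← map_mul, ← C_mul,
        div_mul_cancel₀ _ hc1]
      simp
    have hc1' : algebraMap k[X] (RatFunc k) (C c1) ≠ 0 :=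
      RatFunc.algebraMap_ne_zero (C_ne_zero.mpr hc1)
    rw [hL, hb, hCdiv, moore_eq_prod i u hm', hden, hmpow, hnum, hprod1, hprod0, hsplit]
    generalize algebraMap k[X] (RatFunc k) (C c1) = C1 at *
    generalize algebraMap k[X] (RatFunc k) (C c0) = C0 at *
    generalize moore p (u ∘ i.succAbove) = D at *
    generalize ∏ a ∈ S, (ratLin a)⁻¹ ^ n0 a = W at *
    generalize (∏ a ∈ T, ratLin a) ^ p ^ m = V at *
    rw [pow_add]
    field_simp

end Residues

/-! ### The tuple attached to a basis of a space of forms -/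

section Criterion

variable {p : ℕ} [Fact p.Prime] {k : Type*} [Field k] [Algebra (ZMod p) k]

/-- The tuple dual to the coefficients of a basis of a space of forms consists of polynomials of
degree `lam`, and so do all its base changes. -/
theorem exists_isAdmissible_formOf_eq [IsAlgClosed k] {m lam : ℕ} {ω : Fin (m + 1) → Form k}
    (hΩ : IsSpaceL p (lam * p ^ m) (m + 1) (Submodule.span (ZMod p) (Set.range ω))) :
    ∃ Q : Fin (m + 1) → k[X], IsAdmissible p lam Q ∧ (∀ i, ω i = formOf p Q i) ∧
      DicksonCondition p Q := by
  obtain ⟨-, -, hω⟩ := (isSpaceL_span_iff ω).mp hΩ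
  set u : Fin (m + 1) → RatFunc k := fun i => coeffForm k (ω i) with hu
  have hres : ∀ i, ∃ h : k →₀ ZMod p,
      Finsupp.linearCombination (ZMod p) (fun a : k => (ratLin a)⁻¹) h = u i := fun i => by
    have h1 := (hω (Pi.single i 1) (by simp)).2.1
    rw [comb_single, isLogarithmic_iff (p := p)] at h1
    exact Finsupp.mem_span_range_iff_exists_finsupp.mp h1
  choose h hh using hres
  have hcomb : ∀ ε : Fin (m + 1) → ZMod p, coeffForm k (comb ε ω) =
      (comb ε h).sum fun a c => c • (ratLin a)⁻¹ := fun ε => by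
    have h1 := map_comb (Finsupp.linearCombination (ZMod p)
      (fun a : k => (ratLin a)⁻¹)).toAddMonoidHom ε h
    have h2 : (Finsupp.linearCombination (ZMod p)
      (fun a : k => (ratLin a)⁻¹)).toAddMonoidHom ∘ h = u := funext hh
    rw [h2] at h1
    rw [coeffForm_comb, ← h1]
    rfl
  have hfac : ∀ ε : Fin (m + 1) → ZMod p, ε ≠ 0 → (comb ε h).support.card = lam * p ^ m ∧
      ∃ c : k, c ≠ 0 ∧ comb ε u = algebraMap k[X] (RatFunc k) (C c) *
        ∏ a ∈ (comb ε h).support, (ratLin a)⁻¹ := fun ε hε => by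
    obtain ⟨h1, -, h3, h4⟩ := hω ε hε
    have := eq_div_prod_of_orderAt (comb ε h) (hcomb ε) h1 h4 h3
    rwa [coeffForm_comb] at this
  have hune : ∀ ε : Fin (m + 1) → ZMod p, ε ≠ 0 → comb ε u ≠ 0 := fun ε hε h0 => by
    rw [← coeffForm_comb] at h0
    exact (hω ε hε).1 ((map_eq_zero_iff _ (coeffForm k).injective).mp h0)
  -- the dual tuple exists for every base change of `u`
  have hdual : ∀ M N : Matrix (Fin (m + 1)) (Fin (m + 1)) (ZMod p), M * Nᵀ = 1 →
      moore p (fun i => comb (M i) u) ≠ 0 ∧ ∃ Q : Fin (m + 1) → k[X],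
        (∀ i, Q i ≠ 0 ∧ (Q i).natDegree = lam) ∧
        IsDual p (fun i => comb (M i) u) (fun i => algebraMap k[X] (RatFunc k) (Q i)) := by
    intro M N hMN
    have hm : moore p (fun i => comb (M i) u) ≠ 0 := moore_ne_zero fun ε hε => by
      rw [comb_comb]
      exact hune _ (vecMul_ne_zero hMN hε)
    have := exists_dual_entry (lam := lam) (fun i => comb (M i) h) (fun i => comb (M i) u)
      (fun ε hε => by
        rw [comb_comb, comb_comb]
        exact (hfac _ (vecMul_ne_zero hMN hε)).2)
      (fun ε hε => by
        rw [comb_comb]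
        exact (hfac _ (vecMul_ne_zero hMN hε)).1)
    choose Q hQ0 hQdeg hQ using this
    exact ⟨hm, Q, fun i => ⟨hQ0 i, hQdeg i⟩, (isDual_iff_pow hm).mpr hQ⟩
  have hone : (fun i => comb ((1 : Matrix (Fin (m + 1)) (Fin (m + 1)) (ZMod p)) i) u) = u := by
    funext i
    simp [comb, Matrix.one_apply, ite_smul]
  obtain ⟨-, Q, -, hQ⟩ := hdual 1 1 (by simp)
  rw [hone] at hQ
  have hadm : IsAdmissible p lam Q := by
    rw [isAdmissible_iff]
    intro ε hε
    -- the combination is an entry of the base change by `N`, dual to the base change of `u` by `M`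
    obtain ⟨i, N, M, hNM, hi⟩ := exists_matrix_row ε hε
    have hMN : Mᵀ * N = 1 := by
      rw [← Matrix.transpose_transpose N, ← Matrix.transpose_mul, hNM, Matrix.transpose_one]
    obtain ⟨hm, Q', hQ', hd⟩ := hdual M N (mul_eq_one_comm.mp hNM)
    have h1 := congrFun (hd.unique hm (hQ.baseChange hMN)) i
    simp only [hi, ← algebraMap_comb] at h1
    rw [← RatFunc.algebraMap_injective k h1]
    exact hQ' i
  have hform : ∀ i, ω i = formOf p Q i := fun i =>
    (coeffForm k).injective ((isDual_algebraMap_iff hadm.moore_ne_zero).mp hQ i)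
  refine ⟨Q, hadm, hform, ?_⟩
  have hfun : ω = formOf p Q := funext hform
  obtain ⟨h1, h2, -⟩ := hω (Pi.single 0 1) (by simp)
  rw [hfun] at h1 h2
  exact dicksonCondition_of_isLogarithmic hadm.moore_ne_zero _ h1 h2

theorem exists_span_eq_of_isSpaceL {N m : ℕ} {Ω : Submodule (ZMod p) (Form k)}
    (h : IsSpaceL p N (m + 1) Ω) :
    ∃ ω : Fin (m + 1) → Form k, Ω = Submodule.span (ZMod p) (Set.range ω) := by
  have hfin : Module.Finite (ZMod p) Ω :=
    Module.finite_of_finrank_pos (by rw [h.finrank_eq]; exact m.succ_pos)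
  let b := Module.finBasisOfFinrankEq (ZMod p) Ω h.finrank_eq
  refine ⟨fun i => (b i : Form k), ?_⟩
  have h1 : Set.range (fun i => (b i : Form k)) = Ω.subtype '' Set.range b := by
    rw [← Set.range_comp]
    rfl
  rw [h1, Submodule.span_image, b.span_eq, Submodule.map_subtype_top]

end Criterion

end LSpace

end

theorem mainTheorem2 (p : ℕ) [Fact p.Prime] (k : Type*) [Field k] [IsAlgClosed k]
    [Algebra (ZMod p) k] (n lam : ℕ) (hn : 2 ≤ n) (hlam : 1 ≤ lam) :
    -- the criterion for a family `ω_1, …, ω_n` of forms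
    (∀ ω : Fin n → LSpace.Form k,
      LSpace.IsSpaceL p (lam * p ^ (n - 1)) n (Submodule.span (ZMod p) (Set.range ω)) ↔
        ∃ Q : Fin n → Polynomial k, LSpace.IsAdmissible p lam Q ∧
          (∀ i, ω i = LSpace.formOf p Q i) ∧ LSpace.DicksonCondition p Q) ∧
    -- the criterion for a space of forms
    (∀ Ω : Submodule (ZMod p) (LSpace.Form k),
      LSpace.IsSpaceL p (lam * p ^ (n - 1)) n Ω ↔
        ∃ Q : Fin n → Polynomial k, LSpace.IsAdmissible p lam Q ∧
          Ω = Submodule.span (ZMod p) (Set.range (LSpace.formOf p Q)) ∧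
          LSpace.DicksonCondition p Q) ∧
    -- one nonzero logarithmic form suffices
    (∀ Q : Fin n → Polynomial k, LSpace.IsAdmissible p lam Q →
      (∃ ω ∈ Submodule.span (ZMod p) (Set.range (LSpace.formOf p Q)),
        ω ≠ 0 ∧ LSpace.IsLogarithmic ω) →
      LSpace.IsSpaceL p (lam * p ^ (n - 1)) n
        (Submodule.span (ZMod p) (Set.range (LSpace.formOf p Q)))) ∧
    -- every space arises from a tuple, and then each `P_i` divides `P`
    (∀ Ω : Submodule (ZMod p) (LSpace.Form k),
      LSpace.IsSpaceL p (lam * p ^ (n - 1)) n Ω →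
        ∃ Q : Fin n → Polynomial k, LSpace.IsAdmissible p lam Q ∧
          (∀ i, LSpace.numerator p Q i ∣ LSpace.moore p Q) ∧
          Ω = Submodule.span (ZMod p) (Set.range (LSpace.formOf p Q))) := by
  obtain ⟨m, rfl⟩ : ∃ m, n = m + 1 := ⟨n - 1, by omega⟩
  simp only [Nat.add_sub_cancel]
  have hN : 1 < lam * p ^ m :=
    (Nat.one_lt_pow (by omega) (Fact.out : p.Prime).one_lt).trans_le
      (Nat.le_mul_of_pos_left _ hlam)
  have key : ∀ Ω : Submodule (ZMod p) (LSpace.Form k), LSpace.IsSpaceL p (lam * p ^ m) (m + 1) Ω →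
      ∃ Q : Fin (m + 1) → Polynomial k, LSpace.IsAdmissible p lam Q ∧
        Ω = Submodule.span (ZMod p) (Set.range (LSpace.formOf p Q)) ∧
        LSpace.DicksonCondition p Q := by
    intro Ω hΩ
    obtain ⟨ω, rfl⟩ := LSpace.exists_span_eq_of_isSpaceL hΩ
    obtain ⟨Q, hQ, hω, hD⟩ := LSpace.exists_isAdmissible_formOf_eq hΩ
    exact ⟨Q, hQ, by rw [funext hω], hD⟩
  refine ⟨fun ω => ⟨LSpace.exists_isAdmissible_formOf_eq, ?_⟩, fun Ω => ⟨key Ω, ?_⟩, ?_, ?_⟩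
  · rintro ⟨Q, hQ, hω, hD⟩
    rw [funext hω]
    exact LSpace.isSpaceL_of_dicksonCondition hN hQ hD
  · rintro ⟨Q, hQ, rfl, hD⟩
    exact LSpace.isSpaceL_of_dicksonCondition hN hQ hD
  · rintro Q hQ ⟨ω, hω, hne, hlog⟩
    obtain ⟨ε, rfl⟩ := (Submodule.mem_span_range_iff_exists_fun (ZMod p)).mp hω
    exact LSpace.isSpaceL_of_dicksonCondition hN hQ
      (LSpace.dicksonCondition_of_isLogarithmic hQ.moore_ne_zero ε hne hlog)
  · intro Ω hΩ
    obtain ⟨Q, hQ, hQΩ, -⟩ := key Ω hΩ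
    exact ⟨Q, hQ, fun i => ⟨_, (LSpace.exists_moore_eq_numerator_mul hQ i).2.choose_spec.2.2⟩, hQΩ⟩
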